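/- Let $\mathcal X,\mathcal Y$ be Polish spaces, $\mu\in\mathcal P(\mathcal X)$, $\nu\in\mathcal P(\mathcal Y)$, $m=\mu\times\nu$, and let $\Pi(\mu,\nu)$ be the set of probability measures on $\mathcal X\times\mathcal Y$ with marginals $\mu$ and $\nu$. Let $c:\mathcal X\times\mathcal Y\to\mathbb R$ be continuous with $c(x,y)\ge a(x)+b(y)$ for some $a\in L^1(\mu)$, $b\in L^1(\nu)$, and let $c_\eta:\mathcal X\times\mathcal Y\to\mathbb R$, $\eta>0$, be measurable functions with $c_\eta\to c$ uniformly on $\mathcal X\times\mathcal Y$ as $\eta\downarrow0$. Assume that for every $\eta>0$ there is some $\pi'\in\Pi(\mu,\nu)$ with $\int c_\eta\,d\pi'+\eta\,\mathcal H(\pi'\,\|\,m)<\infty$, where $\mathcal H$ is the relative entropy, and let $$\pi_\eta=\operatorname*{arg\,min}_{\pi'\in\Pi(\mu,\nu)}\ \int c_\eta\,d\pi'+\eta\,\mathcal H(\pi'\,\|\,m).$$ Assume that $\pi_\eta\to\pi$ weakly as $\eta\downarrow0$, and put $\Gamma=\operatorname{spt}\pi$, $\mathcal X_0=\operatorname{proj}_{\mathcal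 X}\Gamma$, $\mathcal Y_0=\operatorname{proj}_{\mathcal Y}\Gamma$. A function $\psi:\mathcal X\to(-\infty,\infty]$ is called a Kantorovich potential if there is $\phi:\mathcal Y\to[-\infty,\infty]$ with $\psi(x)=\sup_{y\in\mathcal Y}(\phi(y)-c(x,y))$ for all $x$, and if $-\psi(x)+\psi^c(y)=c(x,y)$ for all $(x,y)\in\Gamma$, where $\psi^c(y)=\inf_{x\in\mathcal X}(\psi(x)+c(x,y))$. Assume that for any two Kantorovich potentials $\psi_1,\psi_2$ the difference $\psi_1-\psi_2$ is constant on $\mathcal X_0$. Define $$I(x,y)=\sup_{k\ge2}\ \sup_{(x_i,y_i)_{i=2}^k\subseteq\Gamma}\ \sup_{\sigma\in\Sigma(k)}\ \Big(\sum_{i=1}^k c(x_i,y_i)-\sum_{i=1}^k c(x_i,y_{\sigma(i)})\Big),\qquad (x_1,y_1)=(x,y),$$ where $\Sigma(k)$ is the set of permutations of $\{1,\dots,k\}$. Then $I$ is a lower semicontinuous function $\mathcal X\times\mathcal Y\to[0,\infty]$, and: 1. for every (relatively) open set $G\subseteq\mathcal X_0\times\mathcal Y_0$, $$-\inf_{(x,y)\in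 G}I(x,y)\le\liminf_{\eta\downarrow0}\eta\log\pi_\eta(G);$$ 2. for every compact set $K\subseteq\mathcal X\times\mathcal Y$, $$\limsup_{\eta\downarrow0}\eta\log\pi_\eta(K)\le-\inf_{(x,y)\in K}I(x,y);$$ 3. for every Kantorovich potential $\psi$ and all $(x,y)\in\mathcal X_0\times\mathcal Y_0$, $I(x,y)=c(x,y)-\big(-\psi(x)+\psi^c(y)\big)$. -/

import Mathlib

open MeasureTheory Filter Topology
open scoped ENNReal

noncomputable section

namespace EOT

variable {X Y : Type*} [MeasurableSpace X] [MeasurableSpace Y]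

/-- The couplings of `μ` and `ν`: probability measures on `X × Y` with marginals `μ` and `ν`. -/
def Couplings (μ : ProbabilityMeasure X) (ν : ProbabilityMeasure Y) :
    Set (ProbabilityMeasure (X × Y)) :=
  {π | (π : Measure (X × Y)).map Prod.fst = (μ : Measure X) ∧
    (π : Measure (X × Y)).map Prod.snd = (ν : Measure Y)}

/-- The extended-real integral `∫ f dρ = ∫ f⁺ dρ - ∫ f⁻ dρ`. It is the usual one whenever
one of the two parts is finite. -/
def extIntegral {Ω : Type*} [MeasurableSpace Ω] (ρ : Measure Ω) (f : Ω → ℝ) : EReal :=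
  ((∫⁻ ω, ENNReal.ofReal (f ω) ∂ρ : ℝ≥0∞) : EReal) -
    ((∫⁻ ω, ENNReal.ofReal (-f ω) ∂ρ : ℝ≥0∞) : EReal)

/-- The entropic transport cost `∫ c dπ + ε H(π ‖ μ × ν)`. The Kullback-Leibler divergence
`klDiv` takes values in `[0, ∞]`, and is `∞` when `π` is not absolutely continuous. -/
def entropicCost (μ : ProbabilityMeasure X) (ν : ProbabilityMeasure Y) (c : X × Y → ℝ) (ε : ℝ)
    (π : ProbabilityMeasure (X × Y)) : EReal :=
  extIntegral (π : Measure (X × Y)) c +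
    (ε : EReal) * ((InformationTheory.klDiv (π : Measure (X × Y))
      ((μ : Measure X).prod (ν : Measure Y)) : ℝ≥0∞) : EReal)

/-- `π` minimizes the entropic optimal transport problem with cost `c` and regularization `ε`. -/
def IsEntropicMinimizer (μ : ProbabilityMeasure X) (ν : ProbabilityMeasure Y) (c : X × Y → ℝ)
    (ε : ℝ) (π : ProbabilityMeasure (X × Y)) : Prop :=
  π ∈ Couplings μ ν ∧ ∀ π' ∈ Couplings μ ν, entropicCost μ ν c ε π ≤ entropicCost μ ν c ε π'

end EOT

namespace EOT

variable {X Y : Type*}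

/-- The cyclical rate function
`I(x, y) = sup_{k ≥ 2} sup_{(x_i, y_i)_{i=2}^k ⊆ Γ} sup_σ ∑ c(x_i, y_i) - ∑ c(x_i, y_{σ(i)})`,
where `(x_1, y_1) = (x, y)`. Here `k = n + 2`, the tuple `z` lists the `n + 1` points taken
from `Γ`, and `Fin.cons p z` puts `p = (x, y)` in front of it. -/
def cyclicalRate (c : X × Y → ℝ) (Γ : Set (X × Y)) (p : X × Y) : EReal :=
  ⨆ (n : ℕ) (z : Fin (n + 1) → X × Y) (_ : ∀ i, z i ∈ Γ) (σ : Equiv.Perm (Fin (n + 2))),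
    (((∑ i, c ((Fin.cons p z : Fin (n + 2) → X × Y) i)) -
      ∑ i, c (((Fin.cons p z : Fin (n + 2) → X × Y) i).1,
        ((Fin.cons p z : Fin (n + 2) → X × Y) (σ i)).2) : ℝ) : EReal)

/-- The `c`-transform `ψ^c(y) = inf_x (ψ(x) + c(x, y))`. -/
def cTransform (c : X × Y → ℝ) (ψ : X → EReal) (y : Y) : EReal :=
  ⨅ x, (ψ x + (c (x, y) : EReal))

/-- `ψ : X → (-∞, ∞]` is `c`-convex: `ψ(x) = sup_y (φ(y) - c(x, y))` for some
`φ : Y → [-∞, ∞]`. -/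
def IsCConvex (c : X × Y → ℝ) (ψ : X → EReal) : Prop :=
  (∀ x, ψ x ≠ ⊥) ∧ ∃ φ : Y → EReal, ∀ x, ψ x = ⨆ y, (φ y - (c (x, y) : EReal))

/-- The `c`-subdifferential `{(x, y) : -ψ(x) + ψ^c(y) = c(x, y)}`. In `EReal`, the equation
forces `ψ(x)` and `ψ^c(y)` to be finite. -/
def cSubdifferential (c : X × Y → ℝ) (ψ : X → EReal) : Set (X × Y) :=
  {p | -ψ p.1 + cTransform c ψ p.2 = (c p : EReal)}

/-- A Kantorovich potential relative to `Γ`: a `c`-convex function whose `c`-subdifferential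
contains `Γ`. -/
def IsKantorovichPotential (c : X × Y → ℝ) (Γ : Set (X × Y)) (ψ : X → EReal) : Prop :=
  IsCConvex c ψ ∧ Γ ⊆ cSubdifferential c ψ

/-- Uniqueness of Kantorovich potentials: any two of them differ by a constant on the
projection of `Γ` to `X`. -/
def UniqueKantorovichPotentials (c : X × Y → ℝ) (Γ : Set (X × Y)) : Prop :=
  ∀ ψ₁ ψ₂ : X → EReal, IsKantorovichPotential c Γ ψ₁ → IsKantorovichPotential c Γ ψ₂ →
    ∃ r : ℝ, ∀ x ∈ Prod.fst '' Γ, ψ₁ x - ψ₂ x = (r : EReal)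

end EOT

end

/-! The argument rests on the Gibbs shape of the minimizers: for small `η`, `π_η` has density `u(x)
v(y) exp(-c_η / η)` with respect to `μ × ν`. In a product of such densities along a cycle, permuting
the second coordinates changes only the exponential factors. The shape itself is variational: moving
mass from `(x, y')`, `(x', y)` to `(x, y)`, `(x', y')` keeps the marginals, so minimality in both
directions gives an almost sure four-point identity for the density, and freezing one of its two
points splits the density (`exchange_le`, `exists_product_density`).

On small rectangles, where the cost is nearly constant, this becomes an approximate inequality
between products of `π_η`-masses (`HasProductForm.prod_rectangles_le`). If all points of a cycle but
the first lie in `Γ`, their rectangles keep mass bounded below, while the permuted product is at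
most one; hence the first rectangle has mass at most about `exp(-gain / η)`. Taking the best cycle
gives the upper bound with rate `I` near a point (`exists_nhds_eventually_measure_le`), and finite
covers give it on compact sets. Since points of `Γ` cannot have exponentially small neighbourhoods,
also `I ≤ 0` on `Γ`: the support is cyclically monotone.

For the lower bound, let `(x, y')` and `(x', y)` be in `Γ`. The four-cycle bounds from below the
product of the masses near `(x, y)` and `(x', y')`, with exponent `c(x, y) + c(x', y') - c(x, y') -
c(x', y)`. The upper bound at `(x', y')` controls the second factor, and what remains is exactly
`I(x, y)` because `I(x, y) + I(x', y')` equals this cost difference. That identity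
(`cyclicalRate_add_cyclicalRate`) is where uniqueness enters: each section `I(·, y) - c(·, y)` with
`y ∈ Y₀` is a Kantorovich potential, so two sections differ by a constant on `X₀`. The same sections
give the formula for `I` in terms of any potential. -/

namespace EOT

/-! ### Measures given by real densities -/

section Density

variable {Z : Type*} [MeasurableSpace Z] {m : Measure Z}

lemma integrable_withDensity_ofReal_iff {q f : Z → ℝ} (hq : Measurable q) (hq0 : ∀ z, 0 ≤ q z) :
    Integrable f (m.withDensity fun z => ENNReal.ofReal (q z)) ↔
      Integrable (fun z => q z * f z) m := by
  rw [integrable_withDensity_iff_integrable_smul' (by fun_prop) (by simp)]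
  simp [ENNReal.toReal_ofReal (hq0 _)]

lemma integral_withDensity_ofReal {q f : Z → ℝ} (hq : Measurable q) (hq0 : ∀ z, 0 ≤ q z) :
    ∫ z, f z ∂(m.withDensity fun z => ENNReal.ofReal (q z)) = ∫ z, q z * f z ∂m := by
  rw [integral_withDensity_eq_integral_toReal_smul (by fun_prop) (by simp)]
  simp [ENNReal.toReal_ofReal (hq0 _)]

lemma llr_withDensity_ofReal [SigmaFinite m] {q : Z → ℝ} (hq : Measurable q)
    (hq0 : ∀ z, 0 ≤ q z) :
    llr (m.withDensity fun z => ENNReal.ofReal (q z)) m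
      =ᵐ[m.withDensity fun z => ENNReal.ofReal (q z)] fun z => Real.log (q z) := by
  have h := Measure.rnDeriv_withDensity m (f := fun z => ENNReal.ofReal (q z)) (by fun_prop)
  filter_upwards [(withDensity_absolutelyContinuous m _).ae_le h] with z hz
  simp [llr, hz, ENNReal.toReal_ofReal (hq0 _)]

/-- A measure dominated by `m` and concentrated on `T` has a density with values in `[0, 1]`
that vanishes off `T`. -/
lemma exists_density_of_le [IsFiniteMeasure m] {γ : Measure Z} (h : γ ≤ m) {T : Set Z}
    (hT : MeasurableSet T) (hγT : γ Tᶜ = 0) :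
    ∃ a : Z → ℝ, Measurable a ∧ (∀ z, 0 ≤ a z) ∧ (∀ z, a z ≤ 1) ∧ (∀ z, a z ≠ 0 → z ∈ T) ∧
      γ = m.withDensity fun z => ENNReal.ofReal (a z) := by
  have : IsFiniteMeasure γ := isFiniteMeasure_of_le m h
  have hac : γ ≪ m := Measure.absolutelyContinuous_of_le h
  have h1 := Measure.rnDeriv_le_one_of_le h
  have h2 : m.withDensity (γ.rnDeriv m) = γ := Measure.withDensity_rnDeriv_eq γ m hac
  have h3 : ∀ᵐ z ∂m, γ.rnDeriv m z ≠ 0 → z ∈ T := by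
    rw [← ae_withDensity_iff (Measure.measurable_rnDeriv γ m), h2]
    exact hγT
  refine ⟨T.indicator fun z => min 1 (γ.rnDeriv m z).toReal, ?_, ?_, ?_, ?_, ?_⟩
  · exact Measurable.indicator (by fun_prop) hT
  · intro z; exact Set.indicator_nonneg (fun _ _ => by positivity) z
  · intro z
    by_cases hz : z ∈ T <;> simp [hz]
  · intro z hz; by_contra hzT; simp [hzT] at hz
  · conv_lhs => rw [← h2]
    refine withDensity_congr_ae ?_
    filter_upwards [h1, h3] with z hz1 hz3
    have hz1 : γ.rnDeriv m z ≤ 1 := hz1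
    have hf : γ.rnDeriv m z ≠ ⊤ := (hz1.trans_lt ENNReal.one_lt_top).ne
    by_cases hz : z ∈ T
    · have : (γ.rnDeriv m z).toReal ≤ 1 := ENNReal.toReal_le_of_le_ofReal zero_le_one (by simpa)
      simp [hz, this, hf]
    · simp only [hz, imp_false, not_not] at hz3
      simp [hz, hz3]

end Density

/-! ### The entropic cost as a real number -/

section Cost

variable {X Y : Type*} [MeasurableSpace X] [MeasurableSpace Y]
  {μ : ProbabilityMeasure X} {ν : ProbabilityMeasure Y} {C : X × Y → ℝ} {η : ℝ}

lemma extIntegral_of_integrable {Ω : Type*} [MeasurableSpace Ω] {ρ : Measure Ω} {f : Ω → ℝ}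
    (hf : Integrable f ρ) : extIntegral ρ f = ((∫ ω, f ω ∂ρ : ℝ) : EReal) := by
  have h1 : ∫⁻ ω, ENNReal.ofReal (f ω) ∂ρ ≠ ⊤ := hf.lintegral_lt_top.ne
  have h2 : ∫⁻ ω, ENNReal.ofReal (-f ω) ∂ρ ≠ ⊤ := hf.neg.lintegral_lt_top.ne
  rw [extIntegral, integral_eq_lintegral_pos_part_sub_lintegral_neg_part hf, EReal.coe_sub,
    EReal.coe_ennreal_toReal h1, EReal.coe_ennreal_toReal h2]

lemma klDiv_of_integrable_llr {Ω : Type*} [MeasurableSpace Ω] {ρ m : Measure Ω}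
    [IsProbabilityMeasure ρ] [IsProbabilityMeasure m] (hac : ρ ≪ m)
    (h : Integrable (llr ρ m) ρ) :
    ((InformationTheory.klDiv ρ m : ℝ≥0∞) : EReal) = ((∫ ω, llr ρ m ω ∂ρ : ℝ) : EReal) := by
  rw [← InformationTheory.toReal_klDiv_of_measure_eq hac (by simp),
    EReal.coe_ennreal_toReal (InformationTheory.klDiv_ne_top hac h)]

lemma entropicCost_of_density {ρ : ProbabilityMeasure (X × Y)} {q : X × Y → ℝ}
    (hq : Measurable q) (hq0 : ∀ z, 0 ≤ q z)
    (hρ : (ρ : Measure (X × Y)) =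
      ((μ : Measure X).prod (ν : Measure Y)).withDensity fun z => ENNReal.ofReal (q z))
    (hC : Integrable (fun z => q z * C z) ((μ : Measure X).prod (ν : Measure Y)))
    (hlog : Integrable (fun z => q z * Real.log (q z)) ((μ : Measure X).prod (ν : Measure Y))) :
    entropicCost μ ν C η ρ = ((∫ z, q z * C z ∂((μ : Measure X).prod (ν : Measure Y)) +
      η * ∫ z, q z * Real.log (q z) ∂((μ : Measure X).prod (ν : Measure Y)) : ℝ) : EReal) := by
  have hl := llr_withDensity_ofReal (m := (μ : Measure X).prod (ν : Measure Y)) hq hq0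
  have hac : (ρ : Measure (X × Y)) ≪ (μ : Measure X).prod (ν : Measure Y) := by
    rw [hρ]; exact withDensity_absolutelyContinuous _ _
  rw [← integral_withDensity_ofReal hq hq0, ← integral_withDensity_ofReal hq hq0,
    ← integral_congr_ae hl]
  rw [← integrable_withDensity_ofReal_iff hq hq0] at hC hlog
  rw [← integrable_congr hl] at hlog
  rw [← hρ] at hC hlog ⊢
  rw [entropicCost, extIntegral_of_integrable hC, klDiv_of_integrable_llr hac hlog]
  push_cast
  rfl

/-- With a finite negative part no `∞ - ∞` can occur, and the entropy term is nonnegative; an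
infinite positive part or an infinite divergence would therefore force the cost to be `⊤`. -/
lemma integrable_of_entropicCost_lt_top (hη : 0 < η) (hCm : Measurable C)
    {ρ : ProbabilityMeasure (X × Y)}
    (hneg : ∫⁻ z, ENNReal.ofReal (-C z) ∂(ρ : Measure (X × Y)) ≠ ⊤)
    (hcost : entropicCost μ ν C η ρ < ⊤) :
    Integrable C (ρ : Measure (X × Y)) ∧
      (ρ : Measure (X × Y)) ≪ (μ : Measure X).prod (ν : Measure Y) ∧
      Integrable (llr (ρ : Measure (X × Y)) ((μ : Measure X).prod (ν : Measure Y)))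
        (ρ : Measure (X × Y)) := by
  have hB : ((∫⁻ z, ENNReal.ofReal (-C z) ∂(ρ : Measure (X × Y)) : ℝ≥0∞) : EReal) ≠ ⊤ := by
    simpa using hneg
  have hA : ∫⁻ z, ENNReal.ofReal (C z) ∂(ρ : Measure (X × Y)) ≠ ⊤ := by
    intro h
    have hb : (η : EReal) * ((InformationTheory.klDiv (ρ : Measure (X × Y))
      ((μ : Measure X).prod (ν : Measure Y)) : ℝ≥0∞) : EReal) ≠ ⊥ := by
      refine (EReal.bot_lt_zero.trans_le ?_).ne'
      exact mul_nonneg (EReal.coe_nonneg.2 hη.le) (EReal.coe_ennreal_nonneg _)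
    rw [entropicCost, extIntegral, h, EReal.coe_ennreal_top, EReal.top_sub hB,
      EReal.top_add_of_ne_bot hb] at hcost
    exact lt_irrefl _ hcost
  have hint : Integrable C (ρ : Measure (X × Y)) := by
    refine ⟨hCm.aestronglyMeasurable, ?_⟩
    rw [hasFiniteIntegral_iff_norm]
    have : ∀ z, ENNReal.ofReal ‖C z‖ = ENNReal.ofReal (C z) + ENNReal.ofReal (-C z) := by
      intro z
      rcases le_total 0 (C z) with h | h
      · simp [abs_of_nonneg h, ENNReal.ofReal_of_nonpos (neg_nonpos.2 h)]
      · simp [abs_of_nonpos h, ENNReal.ofReal_of_nonpos h]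
    simp_rw [this]
    rw [lintegral_add_left (by fun_prop)]
    exact ENNReal.add_lt_top.2 ⟨hA.lt_top, hneg.lt_top⟩
  have hkl : InformationTheory.klDiv (ρ : Measure (X × Y))
      ((μ : Measure X).prod (ν : Measure Y)) ≠ ⊤ := by
    intro h
    rw [entropicCost, extIntegral_of_integrable hint, h, EReal.coe_ennreal_top,
      EReal.coe_mul_top_of_pos hη, EReal.coe_add_top] at hcost
    exact lt_irrefl _ hcost
  exact ⟨hint, InformationTheory.klDiv_ne_top_iff.1 hkl⟩

end Cost

/-! ### Convexity estimates for `s log s` -/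

section Perturbation

/-- Tangent line inequality for the convex function `s log s`, with the tangent taken at the new
value `s`. There the slope is finite even when the old value `p` is `0`. -/
lemma mul_log_sub_mul_log_le {s p : ℝ} (hs : 0 < s) (hp : 0 ≤ p) :
    s * Real.log s - p * Real.log p ≤ (s - p) * (1 + Real.log s) := by
  rcases hp.eq_or_lt with rfl | hp
  · simp; nlinarith
  · have h := Real.log_le_sub_one_of_pos (div_pos hs hp)
    rw [Real.log_div hs.ne' hp.ne'] at h
    have := mul_le_mul_of_nonneg_left h hp.le
    rw [mul_sub, mul_sub, mul_div_cancel₀ _ hp.ne'] at this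
    linarith

/-- The perturbed value stays in `[p - ε, p + ε]`, so the slope at it is at most `1 + log (p + ε)`
for mass added and at least `1 + log (p - ε)` for mass removed. The resulting bound is linear in `a`
and `b` separately and can be integrated. -/
lemma mul_log_perturb_le {p a b ε : ℝ} (hε : 0 < ε) (hp : 0 ≤ p) (ha : 0 ≤ a) (ha2 : a ≤ 2)
    (hb : 0 ≤ b) (hb2 : b ≤ 2) (hpb : b ≠ 0 → 2 * ε ≤ p) :
    (p + ε / 2 * (a - b)) * Real.log (p + ε / 2 * (a - b)) ≤
      p * Real.log p + ε / 2 * (a * (1 + Real.log (p + ε)) - b * (1 + Real.log (p - ε))) := by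
  set s := p + ε / 2 * (a - b) with hs
  have hsle : s ≤ p + ε := by nlinarith
  rcases eq_or_ne b 0 with rfl | hb0
  · rcases eq_or_lt_of_le (show 0 ≤ s by rw [hs]; simp; positivity) with h0 | h0
    · have hp0 : p = 0 := by nlinarith [mul_nonneg hε.le ha]
      have ha0 : a = 0 := by
        rw [hp0] at hs; simp only [sub_zero, zero_add] at hs
        rcases mul_eq_zero.1 (hs.symm.trans h0.symm) with h | h
        · linarith
        · exact h
      simp [← h0, hp0, ha0]
    · have h1 := mul_log_sub_mul_log_le h0 hp
      have h2 : Real.log s ≤ Real.log (p + ε) := Real.log_le_log h0 hsle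
      have h3 : s - p = ε / 2 * a := by rw [hs]; ring
      rw [h3] at h1
      have : ε / 2 * a * (1 + Real.log s) ≤ ε / 2 * a * (1 + Real.log (p + ε)) := by gcongr
      linarith
  · have hp2 := hpb hb0
    have hsge : p - ε ≤ s := by nlinarith
    have h0 : 0 < s := by linarith
    have h1 := mul_log_sub_mul_log_le h0 hp
    have h2 : Real.log s ≤ Real.log (p + ε) := Real.log_le_log h0 hsle
    have h4 : Real.log (p - ε) ≤ Real.log s := Real.log_le_log (by linarith) hsge
    have h3 : s - p = ε / 2 * a - ε / 2 * b := by rw [hs]; ring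
    rw [h3] at h1
    have : ε / 2 * a * (1 + Real.log s) ≤ ε / 2 * a * (1 + Real.log (p + ε)) := by gcongr
    have : ε / 2 * b * (1 + Real.log (p - ε)) ≤ ε / 2 * b * (1 + Real.log s) := by gcongr
    linarith

lemma neg_one_le_mul_log {q : ℝ} (hq : 0 ≤ q) : -1 ≤ q * Real.log q := by
  rcases hq.eq_or_lt with rfl | hq
  · simp
  · have := mul_log_sub_mul_log_le one_pos hq.le
    simp at this
    linarith

end Perturbation

/-! ### Exchanging mass along four-cycles -/

section Exchange

lemma integrable_mul_of_bounded_on {Z : Type*} [MeasurableSpace Z] {m : Measure Z}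
    [IsFiniteMeasure m] {a f : Z → ℝ} {T : Set Z} {K : ℝ} (ha : Measurable a)
    (hf : Measurable f) (ha0 : ∀ z, 0 ≤ a z) (ha1 : ∀ z, a z ≤ 1) (haT : ∀ z, a z ≠ 0 → z ∈ T)
    (hK : 0 ≤ K) (hfT : ∀ z ∈ T, |f z| ≤ K) : Integrable (fun z => a z * f z) m := by
  refine Integrable.of_bound (by fun_prop) K (ae_of_all _ fun z => ?_)
  by_cases hz : a z = 0
  · simpa [hz]
  · rw [norm_mul, Real.norm_of_nonneg (ha0 z)]
    calc a z * ‖f z‖ ≤ 1 * K := by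
          gcongr
          · exact ha1 z
          · exact hfT z (haT z hz)
      _ = K := one_mul K

lemma integral_density_mul_eq {Z Ω : Type*} [MeasurableSpace Z] [MeasurableSpace Ω]
    {m : Measure Z} {κ : Measure Ω} {P : Ω → Z} (hP : Measurable P) {a f : Z → ℝ}
    (ha : Measurable a) (ha0 : ∀ z, 0 ≤ a z) (hf : Measurable f)
    (h : κ.map P = m.withDensity fun z => ENNReal.ofReal (a z))
    (hint : Integrable (fun z => a z * f z) m) :
    Integrable (fun ω => f (P ω)) κ ∧ ∫ z, a z * f z ∂m = ∫ ω, f (P ω) ∂κ := by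
  rw [← integral_withDensity_ofReal ha ha0, ← h,
    integral_map hP.aemeasurable hf.aestronglyMeasurable]
  rw [← integrable_withDensity_ofReal_iff ha ha0, ← h,
    integrable_map_measure hf.aestronglyMeasurable hP.aemeasurable] at hint
  exact ⟨hint, rfl⟩

lemma integral_add_sub_add {Z : Type*} [MeasurableSpace Z] {m : Measure Z} {f₁ f₂ g₁ g₂ : Z → ℝ}
    (hf₁ : Integrable f₁ m) (hf₂ : Integrable f₂ m) (hg₁ : Integrable g₁ m)
    (hg₂ : Integrable g₂ m) :
    ∫ z, ((f₁ z + f₂ z) - (g₁ z + g₂ z)) ∂m =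
      (∫ z, f₁ z ∂m + ∫ z, f₂ z ∂m) - (∫ z, g₁ z ∂m + ∫ z, g₂ z ∂m) := by
  rw [← integral_add hf₁ hf₂, ← integral_add hg₁ hg₂]
  exact integral_sub (hf₁.add hf₂) (hg₁.add hg₂)

/-- Lets marginals be compared with the removed mass added to the other side, avoiding subtraction
of measures. -/
lemma measure_eq_of_add_eq {Z : Type*} [MeasurableSpace Z] {ρ π γ : Measure Z}
    [IsFiniteMeasure γ] (h : ρ + γ = π + γ) : ρ = π := by
  ext s _
  have := congrArg (fun κ => κ s) h
  simp only [Measure.add_apply] at this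
  exact (ENNReal.add_left_inj (measure_ne_top γ s)).1 this

variable {X Y : Type*} [MeasurableSpace X] [MeasurableSpace Y]
  {μ : ProbabilityMeasure X} {ν : ProbabilityMeasure Y} {C p : X × Y → ℝ} {η : ℝ}
  {π : ProbabilityMeasure (X × Y)}
  {Ω : Type*} [MeasurableSpace Ω] {κ : Measure Ω} {P₁ P₂ N₁ N₂ : Ω → X × Y}

/-- Moving mass along four-cycles in a region where it would strictly lower the cost of a
minimizer is impossible. -/
lemma measure_eq_zero_of_improvable (hη : 0 < η) (hCm : Measurable C)
    (hmin : IsEntropicMinimizer μ ν C η π) (hp : Measurable p) (hp0 : ∀ z, 0 ≤ p z)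
    (hπ : (π : Measure (X × Y)) =
      ((μ : Measure X).prod (ν : Measure Y)).withDensity fun z => ENNReal.ofReal (p z))
    (hC : Integrable (fun z => p z * C z) ((μ : Measure X).prod (ν : Measure Y)))
    (hlog : Integrable (fun z => p z * Real.log (p z)) ((μ : Measure X).prod (ν : Measure Y)))
    (hP₁ : MeasurePreserving P₁ κ ((μ : Measure X).prod (ν : Measure Y)))
    (hP₂ : MeasurePreserving P₂ κ ((μ : Measure X).prod (ν : Measure Y)))
    (hN₁ : MeasurePreserving N₁ κ ((μ : Measure X).prod (ν : Measure Y)))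
    (hN₂ : MeasurePreserving N₂ κ ((μ : Measure X).prod (ν : Measure Y)))
    (hf₁ : Prod.fst ∘ N₁ = Prod.fst ∘ P₁) (hf₂ : Prod.fst ∘ N₂ = Prod.fst ∘ P₂)
    (hs₁ : Prod.snd ∘ N₁ = Prod.snd ∘ P₂) (hs₂ : Prod.snd ∘ N₂ = Prod.snd ∘ P₁)
    {ε M : ℝ} (hε : 0 < ε) {S : Set Ω} (hS : MeasurableSet S)
    (hSP₁ : ∀ ω ∈ S, p (P₁ ω) ≤ M ∧ |C (P₁ ω)| ≤ M)
    (hSP₂ : ∀ ω ∈ S, p (P₂ ω) ≤ M ∧ |C (P₂ ω)| ≤ M)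
    (hSN₁ : ∀ ω ∈ S, p (N₁ ω) ≤ M ∧ |C (N₁ ω)| ≤ M ∧ 2 * ε ≤ p (N₁ ω))
    (hSN₂ : ∀ ω ∈ S, p (N₂ ω) ≤ M ∧ |C (N₂ ω)| ≤ M ∧ 2 * ε ≤ p (N₂ ω))
    (hSlt : ∀ ω ∈ S, (p (P₁ ω) + ε) * (p (P₂ ω) + ε) * Real.exp ((C (P₁ ω) + C (P₂ ω)) / η) <
      (p (N₁ ω) - ε) * (p (N₂ ω) - ε) * Real.exp ((C (N₁ ω) + C (N₂ ω)) / η)) :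
    κ S = 0 := by
  set m : Measure (X × Y) := (μ : Measure X).prod (ν : Measure Y) with hm
  have hκ : IsFiniteMeasure κ := by
    refine ⟨?_⟩
    rw [← Set.preimage_univ (f := P₁), hP₁.measure_preimage nullMeasurableSet_univ]
    simp
  set κS := κ.restrict S with hκS
  set Tp : Set (X × Y) := {z | p z ≤ M ∧ |C z| ≤ M} with hTp
  set Tn : Set (X × Y) := {z | p z ≤ M ∧ |C z| ≤ M ∧ 2 * ε ≤ p z} with hTn
  have hTpm : MeasurableSet Tp :=
    (measurableSet_le hp measurable_const).inter (measurableSet_le hCm.abs measurable_const)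
  have hTnm : MeasurableSet Tn :=
    (measurableSet_le hp measurable_const).inter
      ((measurableSet_le hCm.abs measurable_const).inter
        (measurableSet_le measurable_const hp))
  have key : ∀ {P : Ω → X × Y} {T : Set (X × Y)}, MeasurePreserving P κ m → MeasurableSet T →
      (∀ ω ∈ S, P ω ∈ T) → ∃ a : X × Y → ℝ, Measurable a ∧ (∀ z, 0 ≤ a z) ∧ (∀ z, a z ≤ 1) ∧
        (∀ z, a z ≠ 0 → z ∈ T) ∧
        κS.map P = m.withDensity fun z => ENNReal.ofReal (a z) := by
    intro P T hP hT hST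
    refine exists_density_of_le ?_ hT ?_
    · rw [← hP.map_eq]
      exact Measure.map_mono Measure.restrict_le_self hP.measurable
    · rw [Measure.map_apply hP.measurable hT.compl, hκS,
        Measure.restrict_apply (hP.measurable hT.compl)]
      convert measure_empty (μ := κ)
      ext ω
      simp only [Set.mem_inter_iff, Set.mem_preimage, Set.mem_compl_iff, Set.mem_empty_iff_false,
        iff_false, not_and]
      exact fun h1 h2 => h1 (hST ω h2)
  obtain ⟨a₁, ha₁, ha₁0, ha₁1, ha₁T, ha₁e⟩ := key hP₁ hTpm hSP₁
  obtain ⟨a₂, ha₂, ha₂0, ha₂1, ha₂T, ha₂e⟩ := key hP₂ hTpm hSP₂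
  obtain ⟨b₁, hb₁, hb₁0, hb₁1, hb₁T, hb₁e⟩ := key hN₁ hTnm hSN₁
  obtain ⟨b₂, hb₂, hb₂0, hb₂1, hb₂T, hb₂e⟩ := key hN₂ hTnm hSN₂
  -- Each of the four densities is at most `1`, so the factor `ε / 2` limits the change to `ε`. Mass
  -- is removed only where `p ≥ 2ε`, which keeps `q` nonnegative.
  set q : X × Y → ℝ := fun z => p z + ε / 2 * ((a₁ z + a₂ z) - (b₁ z + b₂ z)) with hq
  have hqm : Measurable q := by fun_prop
  have hb2ε : ∀ z, b₁ z + b₂ z ≠ 0 → 2 * ε ≤ p z := by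
    intro z hz
    rcases eq_or_ne (b₁ z) 0 with h | h
    · exact (hb₂T z (by simpa [h] using hz)).2.2
    · exact (hb₁T z h).2.2
  have hq0 : ∀ z, 0 ≤ q z := by
    intro z
    have h1 := ha₁0 z; have h2 := ha₂0 z; have h3 := hb₁1 z; have h4 := hb₂1 z
    by_cases hz : b₁ z + b₂ z = 0
    · simp only [hq, hz, sub_zero]; have := hp0 z; positivity
    · have := hb2ε z hz
      simp only [hq]; nlinarith
  -- the competitor is a coupling
  have hsum : ∀ (f g : X × Y → ℝ) (F G : Ω → X × Y), Measurable f → Measurable g →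
      (∀ z, 0 ≤ f z) → (∀ z, 0 ≤ g z) →
      κS.map F = m.withDensity (fun z => ENNReal.ofReal (f z)) →
      κS.map G = m.withDensity (fun z => ENNReal.ofReal (g z)) →
      m.withDensity (fun z => ENNReal.ofReal (ε / 2 * (f z + g z))) =
        ENNReal.ofReal (ε / 2) • (κS.map F + κS.map G) := by
    intro f g F G hf hg hf0 hg0 hF hG
    rw [hF, hG, ← withDensity_add_left (by fun_prop), ← withDensity_smul _ (by fun_prop)]
    congr 1
    ext z
    simp [ENNReal.ofReal_mul (half_pos hε).le, ENNReal.ofReal_add (hf0 z) (hg0 z)]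
  have hbal : m.withDensity (fun z => ENNReal.ofReal (q z)) +
      ENNReal.ofReal (ε / 2) • (κS.map N₁ + κS.map N₂) =
      (π : Measure (X × Y)) + ENNReal.ofReal (ε / 2) • (κS.map P₁ + κS.map P₂) := by
    rw [← hsum b₁ b₂ N₁ N₂ hb₁ hb₂ hb₁0 hb₂0 hb₁e hb₂e,
      ← hsum a₁ a₂ P₁ P₂ ha₁ ha₂ ha₁0 ha₂0 ha₁e ha₂e, hπ, ← withDensity_add_left (by fun_prop),
      ← withDensity_add_left (by fun_prop)]
    congr 1
    ext z
    have h1 := ha₁0 z; have h2 := ha₂0 z; have h3 := hb₁0 z; have h4 := hb₂0 z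
    simp only [Pi.add_apply]
    rw [← ENNReal.ofReal_add (hq0 z) (by positivity), ← ENNReal.ofReal_add (hp0 z) (by positivity)]
    congr 1
    simp only [hq]; ring
  have hfst : (m.withDensity (fun z => ENNReal.ofReal (q z))).map Prod.fst = μ := by
    have h := congrArg (Measure.map Prod.fst) hbal
    simp only [Measure.map_add _ _ measurable_fst, Measure.map_smul,
      Measure.map_map measurable_fst hN₁.measurable, Measure.map_map measurable_fst hN₂.measurable,
      Measure.map_map measurable_fst hP₁.measurable, Measure.map_map measurable_fst hP₂.measurable,
      hf₁, hf₂, hmin.1.1] at h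
    exact @measure_eq_of_add_eq _ _ _ _ _ (Measure.smul_finite _ ENNReal.ofReal_ne_top) h
  have hsnd : (m.withDensity (fun z => ENNReal.ofReal (q z))).map Prod.snd = ν := by
    have h := congrArg (Measure.map Prod.snd) hbal
    simp only [Measure.map_add _ _ measurable_snd, Measure.map_smul,
      Measure.map_map measurable_snd hN₁.measurable, Measure.map_map measurable_snd hN₂.measurable,
      Measure.map_map measurable_snd hP₁.measurable, Measure.map_map measurable_snd hP₂.measurable,
      hs₁, hs₂, hmin.1.2, add_comm (κS.map (Prod.snd ∘ P₂))] at h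
    exact @measure_eq_of_add_eq _ _ _ _ _ (Measure.smul_finite _ ENNReal.ofReal_ne_top) h
  have hprob : IsProbabilityMeasure (m.withDensity (fun z => ENNReal.ofReal (q z))) := by
    refine ⟨?_⟩
    have : (m.withDensity (fun z => ENNReal.ofReal (q z))).map Prod.fst Set.univ = 1 := by
      rw [hfst]; simp
    rwa [Measure.map_apply measurable_fst .univ, Set.preimage_univ] at this
  -- comparison of the costs
  set e₁ : X × Y → ℝ := fun z => C z + η * (1 + Real.log (p z + ε)) with he₁
  set e₂ : X × Y → ℝ := fun z => C z + η * (1 + Real.log (p z - ε)) with he₂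
  have hlogb : ∀ x, ε ≤ x → x ≤ M + ε → |Real.log x| ≤ |Real.log ε| + |Real.log (M + ε)| := by
    intro x h1 h2
    have h3 := Real.log_le_log hε h1
    have h4 := Real.log_le_log (hε.trans_le h1) h2
    rw [abs_le]
    constructor
    · linarith [neg_abs_le (Real.log ε), abs_nonneg (Real.log (M + ε))]
    · linarith [le_abs_self (Real.log (M + ε)), abs_nonneg (Real.log ε)]
  set L := |Real.log ε| + |Real.log (M + ε)| with hL
  have hL0 : 0 ≤ L := by positivity
  have hl₁m : Measurable fun z => Real.log (p z + ε) := by fun_prop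
  have hl₂m : Measurable fun z => Real.log (p z - ε) := by fun_prop
  have hl₁ : ∀ z ∈ Tp, |1 + Real.log (p z + ε)| ≤ 1 + L := fun z hz =>
    (abs_add_le _ _).trans (by
      rw [abs_one]
      exact add_le_add_right (hlogb _ (by linarith [hp0 z]) (by linarith [hz.1])) _)
  have hl₂ : ∀ z ∈ Tn, |1 + Real.log (p z - ε)| ≤ 1 + L := fun z hz =>
    (abs_add_le _ _).trans (by
      rw [abs_one]
      exact add_le_add_right (hlogb _ (by linarith [hz.2.2]) (by linarith [hz.1])) _)
  have iC : ∀ {a : X × Y → ℝ} {T : Set (X × Y)}, Measurable a → (∀ z, 0 ≤ a z) →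
      (∀ z, a z ≤ 1) → (∀ z, a z ≠ 0 → z ∈ T) → T ⊆ Tp → Integrable (fun z => a z * C z) m := by
    intro a T h1 h2 h3 h4 h5
    refine integrable_mul_of_bounded_on (K := |M|) h1 hCm h2 h3 h4 (abs_nonneg _) ?_
    exact fun z hz => (h5 hz).2.trans (le_abs_self _)
  have hTnp : Tn ⊆ Tp := fun z hz => ⟨hz.1, hz.2.1⟩
  have iCa₁ := iC ha₁ ha₁0 ha₁1 ha₁T subset_rfl
  have iCa₂ := iC ha₂ ha₂0 ha₂1 ha₂T subset_rfl
  have iCb₁ := iC hb₁ hb₁0 hb₁1 hb₁T hTnp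
  have iCb₂ := iC hb₂ hb₂0 hb₂1 hb₂T hTnp
  have iLa₁ := integrable_mul_of_bounded_on (m := m) ha₁ (hl₁m.const_add 1) ha₁0 ha₁1 ha₁T
    (by positivity) hl₁
  have iLa₂ := integrable_mul_of_bounded_on (m := m) ha₂ (hl₁m.const_add 1) ha₂0 ha₂1 ha₂T
    (by positivity) hl₁
  have iLb₁ := integrable_mul_of_bounded_on (m := m) hb₁ (hl₂m.const_add 1) hb₁0 hb₁1 hb₁T
    (by positivity) hl₂
  have iLb₂ := integrable_mul_of_bounded_on (m := m) hb₂ (hl₂m.const_add 1) hb₂0 hb₂1 hb₂T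
    (by positivity) hl₂
  have iup : Integrable (fun z => p z * Real.log (p z) + ε / 2 *
      ((a₁ z * (1 + Real.log (p z + ε)) + a₂ z * (1 + Real.log (p z + ε))) -
        (b₁ z * (1 + Real.log (p z - ε)) + b₂ z * (1 + Real.log (p z - ε))))) m :=
    hlog.add (((iLa₁.add iLa₂).sub (iLb₁.add iLb₂)).const_mul _)
  have hle : ∀ z, q z * Real.log (q z) ≤ p z * Real.log (p z) + ε / 2 *
      ((a₁ z * (1 + Real.log (p z + ε)) + a₂ z * (1 + Real.log (p z + ε))) -
        (b₁ z * (1 + Real.log (p z - ε)) + b₂ z * (1 + Real.log (p z - ε)))) := by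
    intro z
    have := mul_log_perturb_le hε (hp0 z) (add_nonneg (ha₁0 z) (ha₂0 z))
      (by linarith [ha₁1 z, ha₂1 z]) (add_nonneg (hb₁0 z) (hb₂0 z))
      (by linarith [hb₁1 z, hb₂1 z]) (hb2ε z)
    exact this.trans_eq (by ring)
  have iqlog : Integrable (fun z => q z * Real.log (q z)) m :=
    integrable_of_le_of_le (by fun_prop) (ae_of_all _ fun z => neg_one_le_mul_log (hq0 z))
      (ae_of_all _ hle) (integrable_const _) iup
  have eqC : (fun z => q z * C z) = fun z => p z * C z + ε / 2 *
      ((a₁ z * C z + a₂ z * C z) - (b₁ z * C z + b₂ z * C z)) := by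
    ext z; simp only [hq]; ring
  have iqC : Integrable (fun z => q z * C z) m := by
    rw [eqC]
    exact hC.add (((iCa₁.add iCa₂).sub (iCb₁.add iCb₂)).const_mul _)
  have hcost := hmin.2 ⟨_, hprob⟩ ⟨hfst, hsnd⟩
  rw [entropicCost_of_density (ρ := ⟨_, hprob⟩) hqm hq0 rfl iqC iqlog,
    entropicCost_of_density hp hp0 hπ hC hlog, EReal.coe_le_coe_iff] at hcost
  have ie : ∀ {a f : X × Y → ℝ}, Integrable (fun z => a z * C z) m →
      Integrable (fun z => a z * (1 + f z)) m →
      Integrable (fun z => a z * (C z + η * (1 + f z))) m := by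
    intro a f h1 h2
    convert! h1.add (h2.const_mul η) using 2 with z
    simp only [Pi.add_apply]; ring
  have ia₁ : Integrable (fun z => a₁ z * e₁ z) m := ie iCa₁ iLa₁
  have ia₂ : Integrable (fun z => a₂ z * e₁ z) m := ie iCa₂ iLa₂
  have ib₁ : Integrable (fun z => b₁ z * e₂ z) m := ie iCb₁ iLb₁
  have ib₂ : Integrable (fun z => b₂ z * e₂ z) m := ie iCb₂ iLb₂
  have he₁m : Measurable e₁ := by fun_prop
  have he₂m : Measurable e₂ := by fun_prop
  obtain ⟨ja₁, ea₁⟩ := integral_density_mul_eq hP₁.measurable ha₁ ha₁0 he₁m ha₁e ia₁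
  obtain ⟨ja₂, ea₂⟩ := integral_density_mul_eq hP₂.measurable ha₂ ha₂0 he₁m ha₂e ia₂
  obtain ⟨jb₁, eb₁⟩ := integral_density_mul_eq hN₁.measurable hb₁ hb₁0 he₂m hb₁e ib₁
  obtain ⟨jb₂, eb₂⟩ := integral_density_mul_eq hN₂.measurable hb₂ hb₂0 he₂m hb₂e ib₂
  -- The guaranteed saving per unit of moved mass: the logarithm of the strict inequality on `S`,
  -- times `η`, makes it positive there, whereas minimality makes its integral over `S` nonpositive.
  set g : Ω → ℝ := fun ω => (e₂ (N₁ ω) + e₂ (N₂ ω)) - (e₁ (P₁ ω) + e₁ (P₂ ω)) with hg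
  have ig : Integrable g κS := (jb₁.add jb₂).sub (ja₁.add ja₂)
  have hgpos : ∀ ω ∈ S, 0 < g ω := by
    intro ω hω
    have h1 := hSlt ω hω
    have p1 : 0 < p (P₁ ω) + ε := by linarith [hp0 (P₁ ω)]
    have p2 : 0 < p (P₂ ω) + ε := by linarith [hp0 (P₂ ω)]
    have p3 : 0 < p (N₁ ω) - ε := by linarith [(hSN₁ ω hω).2.2]
    have p4 : 0 < p (N₂ ω) - ε := by linarith [(hSN₂ ω hω).2.2]
    have h2 := Real.log_lt_log (by positivity) h1
    rw [Real.log_mul (by positivity) (by positivity), Real.log_mul (by positivity) (by positivity),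
      Real.log_exp, Real.log_mul (by positivity) (by positivity),
      Real.log_mul (by positivity) (by positivity), Real.log_exp] at h2
    have h3 := mul_lt_mul_of_pos_left h2 hη
    simp only [mul_add, mul_div_cancel₀ _ hη.ne'] at h3
    simp only [hg, he₁, he₂]
    linarith
  have hgint : ∫ ω, g ω ∂κS ≤ 0 := by
    have hint_g : ∫ ω, g ω ∂κS = (∫ z, b₁ z * e₂ z ∂m + ∫ z, b₂ z * e₂ z ∂m) -
        (∫ z, a₁ z * e₁ z ∂m + ∫ z, a₂ z * e₁ z ∂m) := by
      rw [ea₁, ea₂, eb₁, eb₂, ← integral_add_sub_add jb₁ jb₂ ja₁ ja₂]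
    have hup := integral_mono iqlog iup hle
    have hsplit : ∫ z, q z * C z ∂m + η * ∫ z, (p z * Real.log (p z) + ε / 2 *
        ((a₁ z * (1 + Real.log (p z + ε)) + a₂ z * (1 + Real.log (p z + ε))) -
          (b₁ z * (1 + Real.log (p z - ε)) + b₂ z * (1 + Real.log (p z - ε))))) ∂m =
        ∫ z, p z * C z ∂m + η * ∫ z, p z * Real.log (p z) ∂m +
          ε / 2 * ((∫ z, a₁ z * e₁ z ∂m + ∫ z, a₂ z * e₁ z ∂m) -
            (∫ z, b₁ z * e₂ z ∂m + ∫ z, b₂ z * e₂ z ∂m)) := by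
      rw [← integral_const_mul, ← integral_const_mul, ← integral_add iqC (iup.const_mul η),
        ← integral_add hC (hlog.const_mul η), ← integral_add_sub_add ia₁ ia₂ ib₁ ib₂,
        ← integral_const_mul]
      refine Eq.trans ?_ (integral_add (hC.add (hlog.const_mul η))
        (((ia₁.add ia₂).sub (ib₁.add ib₂)).const_mul (ε / 2)))
      refine integral_congr_ae (ae_of_all _ fun z => ?_)
      simp only [hq, he₁, he₂]
      ring
    have h5 := mul_le_mul_of_nonneg_left hup hη.le
    rw [hint_g]
    nlinarith
  by_contra hne
  have hpos : 0 < ∫ ω, g ω ∂κS := by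
    rw [integral_pos_iff_support_of_nonneg_ae _ ig, hκS]
    · refine (pos_iff_ne_zero.2 hne).trans_le ?_
      rw [← Measure.restrict_apply_self κ S]
      exact measure_mono fun ω hω => (hgpos ω hω).ne'
    · exact (ae_restrict_iff' hS).2 (ae_of_all _ fun ω hω => (hgpos ω hω).le)
  linarith

/-- The exchange inequality along four-cycles for the density of an entropic minimizer. -/
lemma exchange_le (hη : 0 < η) (hCm : Measurable C)
    (hmin : IsEntropicMinimizer μ ν C η π) (hp : Measurable p) (hp0 : ∀ z, 0 ≤ p z)
    (hπ : (π : Measure (X × Y)) =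
      ((μ : Measure X).prod (ν : Measure Y)).withDensity fun z => ENNReal.ofReal (p z))
    (hC : Integrable (fun z => p z * C z) ((μ : Measure X).prod (ν : Measure Y)))
    (hlog : Integrable (fun z => p z * Real.log (p z)) ((μ : Measure X).prod (ν : Measure Y)))
    (hP₁ : MeasurePreserving P₁ κ ((μ : Measure X).prod (ν : Measure Y)))
    (hP₂ : MeasurePreserving P₂ κ ((μ : Measure X).prod (ν : Measure Y)))
    (hN₁ : MeasurePreserving N₁ κ ((μ : Measure X).prod (ν : Measure Y)))
    (hN₂ : MeasurePreserving N₂ κ ((μ : Measure X).prod (ν : Measure Y)))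
    (hf₁ : Prod.fst ∘ N₁ = Prod.fst ∘ P₁) (hf₂ : Prod.fst ∘ N₂ = Prod.fst ∘ P₂)
    (hs₁ : Prod.snd ∘ N₁ = Prod.snd ∘ P₂) (hs₂ : Prod.snd ∘ N₂ = Prod.snd ∘ P₁) :
    ∀ᵐ ω ∂κ, p (N₁ ω) * p (N₂ ω) * Real.exp ((C (N₁ ω) + C (N₂ ω)) / η) ≤
      p (P₁ ω) * p (P₂ ω) * Real.exp ((C (P₁ ω) + C (P₂ ω)) / η) := by
  -- A strict violation survives small shifts of the densities, so every violating point lies in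
  -- some truncated region with `ε = 1 / (n + 1)` and bound `n + 1`.
  let S : ℕ → Set Ω := fun n => {ω |
    ((p (P₁ ω) ≤ n + 1 ∧ |C (P₁ ω)| ≤ n + 1) ∧ (p (P₂ ω) ≤ n + 1 ∧ |C (P₂ ω)| ≤ n + 1)) ∧
    ((p (N₁ ω) ≤ n + 1 ∧ |C (N₁ ω)| ≤ n + 1 ∧ 2 * (1 / ((n : ℝ) + 1)) ≤ p (N₁ ω)) ∧
      (p (N₂ ω) ≤ n + 1 ∧ |C (N₂ ω)| ≤ n + 1 ∧ 2 * (1 / ((n : ℝ) + 1)) ≤ p (N₂ ω))) ∧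
    (p (P₁ ω) + 1 / ((n : ℝ) + 1)) * (p (P₂ ω) + 1 / ((n : ℝ) + 1)) *
        Real.exp ((C (P₁ ω) + C (P₂ ω)) / η) <
      (p (N₁ ω) - 1 / ((n : ℝ) + 1)) * (p (N₂ ω) - 1 / ((n : ℝ) + 1)) *
        Real.exp ((C (N₁ ω) + C (N₂ ω)) / η)}
  have mP₁ := hP₁.measurable
  have mP₂ := hP₂.measurable
  have mN₁ := hN₁.measurable
  have mN₂ := hN₂.measurable
  have hS0 : ∀ n, κ (S n) = 0 := by
    intro n
    refine measure_eq_zero_of_improvable (ε := 1 / ((n : ℝ) + 1)) (M := n + 1) hη hCm hmin hp hp0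
      hπ hC hlog hP₁ hP₂ hN₁ hN₂ hf₁ hf₂ hs₁ hs₂ (by positivity) ?_
      (fun ω h => h.1.1) (fun ω h => h.1.2) (fun ω h => h.2.1.1) (fun ω h => h.2.1.2)
      (fun ω h => h.2.2)
    simp only [S, measurableSet_setOfPred]
    measurability
  refine measure_mono_null ?_ (measure_iUnion_null hS0)
  intro ω hω
  simp only [Set.mem_compl_iff, Set.mem_ofPred_eq, not_le] at hω
  have hNpos : 0 < p (N₁ ω) * p (N₂ ω) := by
    have h0 : 0 ≤ p (P₁ ω) * p (P₂ ω) * Real.exp ((C (P₁ ω) + C (P₂ ω)) / η) :=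
      mul_nonneg (mul_nonneg (hp0 _) (hp0 _)) (Real.exp_pos _).le
    exact pos_of_mul_pos_left (h0.trans_lt hω) (Real.exp_pos _).le
  have h1 : 0 < p (N₁ ω) := pos_of_mul_pos_left hNpos (hp0 _)
  have h2 : 0 < p (N₂ ω) := pos_of_mul_pos_right hNpos (hp0 _)
  have t0 : Tendsto (fun n : ℕ => 1 / ((n : ℝ) + 1)) atTop (𝓝 0) :=
    tendsto_one_div_add_atTop_nhds_zero_nat
  have tT : Tendsto (fun n : ℕ => (n : ℝ) + 1) atTop atTop :=
    tendsto_atTop_add_const_right _ _ tendsto_natCast_atTop_atTop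
  have hbig : ∀ r : ℝ, ∀ᶠ n : ℕ in atTop, r ≤ (n : ℝ) + 1 := fun r => tT.eventually_ge_atTop r
  have hsmall : ∀ r : ℝ, 0 < r → ∀ᶠ n : ℕ in atTop, 2 * (1 / ((n : ℝ) + 1)) ≤ r := by
    intro r hr
    have := t0.const_mul 2
    rw [mul_zero] at this
    exact this.eventually_le_const hr
  have hlt : ∀ᶠ n : ℕ in atTop,
      (p (P₁ ω) + 1 / ((n : ℝ) + 1)) * (p (P₂ ω) + 1 / ((n : ℝ) + 1)) *
        Real.exp ((C (P₁ ω) + C (P₂ ω)) / η) <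
      (p (N₁ ω) - 1 / ((n : ℝ) + 1)) * (p (N₂ ω) - 1 / ((n : ℝ) + 1)) *
        Real.exp ((C (N₁ ω) + C (N₂ ω)) / η) := by
    refine Tendsto.eventually_lt (((t0.const_add _).mul (t0.const_add _)).mul_const _)
      (((t0.const_sub _).mul (t0.const_sub _)).mul_const _) ?_
    simpa using hω
  obtain ⟨n, hn⟩ := ((((hbig (p (P₁ ω))).and (hbig |C (P₁ ω)|)).and
    ((hbig (p (P₂ ω))).and (hbig |C (P₂ ω)|))).and
    ((((hbig (p (N₁ ω))).and ((hbig |C (N₁ ω)|).and (hsmall _ h1))).and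
    ((hbig (p (N₂ ω))).and ((hbig |C (N₂ ω)|).and (hsmall _ h2)))).and hlt)).exists
  exact Set.mem_iUnion.2 ⟨n, hn⟩

end Exchange

/-! ### The Gibbs form of the minimizer -/

section ProductForm

variable {X Y : Type*} [MeasurableSpace X] [MeasurableSpace Y]
  {μ : ProbabilityMeasure X} {ν : ProbabilityMeasure Y} {C : X × Y → ℝ} {η : ℝ}
  {π : ProbabilityMeasure (X × Y)}

/-- An entropic minimizer of finite cost has the density `u(x) v(y) exp(-C(x, y) / η)`. -/
lemma exists_product_density (hη : 0 < η) (hCm : Measurable C)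
    (hmin : IsEntropicMinimizer μ ν C η π)
    (hneg : ∫⁻ z, ENNReal.ofReal (-C z) ∂(π : Measure (X × Y)) ≠ ⊤)
    (hcost : entropicCost μ ν C η π < ⊤) :
    ∃ (u : X → ℝ≥0∞) (v : Y → ℝ≥0∞), Measurable u ∧ Measurable v ∧
      (π : Measure (X × Y)) = ((μ : Measure X).prod (ν : Measure Y)).withDensity
        fun z => u z.1 * v z.2 * ENNReal.ofReal (Real.exp (-C z / η)) := by
  obtain ⟨hCi, hac, hllr⟩ := integrable_of_entropicCost_lt_top hη hCm hneg hcost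
  set m : Measure (X × Y) := (μ : Measure X).prod (ν : Measure Y) with hm
  set p : X × Y → ℝ := fun z => ((π : Measure (X × Y)).rnDeriv m z).toReal with hpdef
  have hp : Measurable p := by fun_prop
  have hp0 : ∀ z, 0 ≤ p z := fun z => ENNReal.toReal_nonneg
  have hπ : (π : Measure (X × Y)) = m.withDensity fun z => ENNReal.ofReal (p z) := by
    conv_lhs => rw [← Measure.withDensity_rnDeriv_eq (π : Measure (X × Y)) m hac]
    refine withDensity_congr_ae ?_
    filter_upwards [Measure.rnDeriv_lt_top (π : Measure (X × Y)) m] with z hz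
    simp [hpdef, hz.ne]
  have hC : Integrable (fun z => p z * C z) m := by
    rwa [hπ, integrable_withDensity_ofReal_iff hp hp0] at hCi
  have hlog : Integrable (fun z => p z * Real.log (p z)) m := by
    rwa [hπ, integrable_congr (llr_withDensity_ofReal hp hp0),
      integrable_withDensity_ofReal_iff hp hp0] at hllr
  have m₁ : MeasurePreserving (Prod.fst : (X × Y) × (X × Y) → X × Y) (m.prod m) m :=
    measurePreserving_fst
  have m₂ : MeasurePreserving (Prod.snd : (X × Y) × (X × Y) → X × Y) (m.prod m) m :=
    measurePreserving_snd
  -- Mixing the coordinates of two independent points again gives the law `m`, as `m` is a product.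
  -- This permits the exchange inequality in both directions, hence equality.
  have n₁ : MeasurePreserving (Prod.map Prod.fst Prod.snd : (X × Y) × (X × Y) → X × Y)
      (m.prod m) m :=
    (measurePreserving_fst (μ := (μ : Measure X)) (ν := (ν : Measure Y))).prod
      (measurePreserving_snd (μ := (μ : Measure X)) (ν := (ν : Measure Y)))
  have n₂ : MeasurePreserving
      ((Prod.map Prod.fst Prod.snd : (X × Y) × (X × Y) → X × Y) ∘ Prod.swap) (m.prod m) m :=
    n₁.comp (Measure.measurePreserving_swap (μ := m) (ν := m))
  have h₁ := exchange_le hη hCm hmin hp hp0 hπ hC hlog m₁ m₂ n₁ n₂ rfl rfl rfl rfl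
  have h₂ := exchange_le hη hCm hmin hp hp0 hπ hC hlog n₁ n₂ m₁ m₂ rfl rfl rfl rfl
  set Z : X × Y → ℝ := fun z => p z * Real.exp (C z / η) with hZ
  have hZm : Measurable Z := by fun_prop
  have hZ0 : ∀ z, 0 ≤ Z z := fun z => mul_nonneg (hp0 z) (Real.exp_pos _).le
  have hprod : ∀ᵐ w ∂m, ∀ᵐ z ∂m, Z (z.1, w.2) * Z (w.1, z.2) = Z w * Z z := by
    refine Measure.ae_ae_of_ae_prod (μ := m) (ν := m)
      (p := fun q => Z (q.2.1, q.1.2) * Z (q.1.1, q.2.2) = Z q.1 * Z q.2) ?_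
    filter_upwards [h₁, h₂] with q hq₁ hq₂
    have h := le_antisymm hq₁ hq₂
    simp only [Function.comp_apply, Prod.map, Prod.swap, add_div, Real.exp_add] at h
    simp only [hZ]
    linarith
  have hpos : ∃ᵐ w ∂m, 0 < Z w := by
    intro h
    have h0 : (fun z => ENNReal.ofReal (p z)) =ᵐ[m] 0 := by
      filter_upwards [h] with z hz
      have : p z ≤ 0 := by
        by_contra hlt
        exact hz (mul_pos (not_le.1 hlt) (Real.exp_pos _))
      simp [this]
    rw [withDensity_congr_ae h0, withDensity_zero] at hπ
    have := congrArg (fun ρ => ρ Set.univ) hπ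
    simp at this
  -- Freezing `w` with `Z w > 0` turns the identity into `Z z = Z (z.1, w.2) * Z (w.1, z.2) / Z w`,
  -- whose factors are `u` and `v`.
  obtain ⟨w, hw, hwz⟩ := (hpos.and_eventually hprod).exists
  refine ⟨fun x => ENNReal.ofReal (Z (x, w.2)), fun y => ENNReal.ofReal (Z (w.1, y) / Z w),
    by fun_prop, by fun_prop, ?_⟩
  rw [hπ]
  refine withDensity_congr_ae ?_
  filter_upwards [hwz] with z hz
  rw [← ENNReal.ofReal_mul (hZ0 _),
    ← ENNReal.ofReal_mul (mul_nonneg (hZ0 _) (div_nonneg (hZ0 _) hw.le)), ← mul_div_assoc, hz,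
    mul_div_cancel_left₀ _ hw.ne']
  simp only [hZ]
  rw [mul_assoc, ← Real.exp_add, neg_div, add_neg_cancel, Real.exp_zero, mul_one]

/-- Under the product form, the mass of a rectangle on which the cost is nearly constant is
comparable to a product. -/
lemma rectangle_bounds (hη : 0 < η) {u : X → ℝ≥0∞} {v : Y → ℝ≥0∞} (hu : Measurable u)
    (hv : Measurable v)
    (hπ : (π : Measure (X × Y)) = ((μ : Measure X).prod (ν : Measure Y)).withDensity
        fun z => u z.1 * v z.2 * ENNReal.ofReal (Real.exp (-C z / η)))
    {A : Set X} {B : Set Y} (hA : MeasurableSet A) (hB : MeasurableSet B) {c₀ δ : ℝ}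
    (hcδ : ∀ a ∈ A, ∀ b ∈ B, |C (a, b) - c₀| ≤ δ) :
    ENNReal.ofReal (Real.exp (-(c₀ + δ) / η)) *
        ((∫⁻ x in A, u x ∂(μ : Measure X)) * ∫⁻ y in B, v y ∂(ν : Measure Y)) ≤
      (π : Measure (X × Y)) (A ×ˢ B) ∧
    (π : Measure (X × Y)) (A ×ˢ B) ≤ ENNReal.ofReal (Real.exp (-(c₀ - δ) / η)) *
        ((∫⁻ x in A, u x ∂(μ : Measure X)) * ∫⁻ y in B, v y ∂(ν : Measure Y)) := by
  have hprod : (∫⁻ x in A, u x ∂(μ : Measure X)) * ∫⁻ y in B, v y ∂(ν : Measure Y) =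
      ∫⁻ z in A ×ˢ B, u z.1 * v z.2 ∂((μ : Measure X).prod (ν : Measure Y)) := by
    rw [← Measure.prod_restrict, lintegral_prod_mul hu.aemeasurable hv.aemeasurable]
  rw [hprod, hπ, withDensity_apply _ (hA.prod hB), ← lintegral_const_mul _ (by fun_prop),
    ← lintegral_const_mul _ (by fun_prop)]
  constructor <;>
  · refine setLIntegral_mono' (hA.prod hB) fun z hz => ?_
    have h := abs_le.1 (hcδ z.1 hz.1 z.2 hz.2)
    rw [mul_comm]
    gcongr
    linarith [h.1, h.2]

end ProductForm

/-! ### The rate function and Kantorovich potentials -/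

section RateFunction

variable {X Y : Type*} {c : X × Y → ℝ} {Γ : Set (X × Y)}

/-- The gain in cost from permuting the second coordinates of the cycle `(x, y), z` by `σ`. -/
noncomputable def cycleGain (c : X × Y → ℝ) (x : X) (y : Y) {n : ℕ} (z : Fin (n + 1) → X × Y)
    (σ : Equiv.Perm (Fin (n + 2))) : ℝ :=
  (c (x, y) + ∑ i, c (z i)) -
    (c (x, (Fin.cons y (fun i => (z i).2) : Fin (n + 2) → Y) (σ 0)) +
      ∑ i : Fin (n + 1),
        c ((z i).1, (Fin.cons y (fun i => (z i).2) : Fin (n + 2) → Y) (σ i.succ)))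

lemma snd_cons {n : ℕ} (p : X × Y) (z : Fin n → X × Y) (j : Fin (n + 1)) :
    ((Fin.cons p z : Fin (n + 1) → X × Y) j).2 =
      (Fin.cons p.2 (fun i => (z i).2) : Fin (n + 1) → Y) j := by
  refine Fin.cases ?_ (fun i => ?_) j <;> simp

lemma cycleGain_eq (x : X) (y : Y) {n : ℕ} (z : Fin (n + 1) → X × Y)
    (σ : Equiv.Perm (Fin (n + 2))) :
    cycleGain c x y z σ = (∑ i, c ((Fin.cons (x, y) z : Fin (n + 2) → X × Y) i)) -
      ∑ i, c (((Fin.cons (x, y) z : Fin (n + 2) → X × Y) i).1,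
        ((Fin.cons (x, y) z : Fin (n + 2) → X × Y) (σ i)).2) := by
  rw [Fin.sum_univ_succ (n := n + 1), Fin.sum_univ_succ (n := n + 1)]
  simp only [snd_cons, Fin.cons_zero, Fin.cons_succ, cycleGain]

lemma cyclicalRate_eq (x : X) (y : Y) :
    cyclicalRate c Γ (x, y) = ⨆ (n : ℕ) (z : Fin (n + 1) → X × Y) (_ : ∀ i, z i ∈ Γ)
      (σ : Equiv.Perm (Fin (n + 2))), (cycleGain c x y z σ : EReal) := by
  simp only [cyclicalRate, cycleGain_eq]

lemma cycleGain_le_cyclicalRate (x : X) (y : Y) {n : ℕ} {z : Fin (n + 1) → X × Y}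
    (hz : ∀ i, z i ∈ Γ) (σ : Equiv.Perm (Fin (n + 2))) :
    (cycleGain c x y z σ : EReal) ≤ cyclicalRate c Γ (x, y) := by
  rw [cyclicalRate_eq]
  exact le_iSup_of_le n (le_iSup_of_le z (le_iSup_of_le hz (le_iSup_of_le σ le_rfl)))

lemma cyclicalRate_le {x : X} {y : Y} {t : EReal}
    (h : ∀ (n : ℕ) (z : Fin (n + 1) → X × Y), (∀ i, z i ∈ Γ) →
      ∀ σ : Equiv.Perm (Fin (n + 2)), (cycleGain c x y z σ : EReal) ≤ t) :
    cyclicalRate c Γ (x, y) ≤ t := by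
  rw [cyclicalRate_eq]
  exact iSup_le fun n => iSup_le fun z => iSup_le fun hz => iSup_le fun σ => h n z hz σ

/-- The identity permutation gains nothing; a point of `Γ` is needed because cycles have length at
least two. -/
lemma cyclicalRate_nonneg (hΓ : Γ.Nonempty) (p : X × Y) : 0 ≤ cyclicalRate c Γ p := by
  obtain ⟨q, hq⟩ := hΓ
  refine le_trans ?_ (cycleGain_le_cyclicalRate p.1 p.2 (n := 0) (z := fun _ => q)
    (fun _ => hq) (Equiv.refl _))
  simp [cycleGain]

lemma lowerSemicontinuous_cyclicalRate [TopologicalSpace X] [TopologicalSpace Y]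
    (hc : Continuous c) : LowerSemicontinuous (cyclicalRate c Γ) := by
  have h : cyclicalRate c Γ = fun p : X × Y => ⨆ (n : ℕ) (z : Fin (n + 1) → X × Y)
      (_ : ∀ i, z i ∈ Γ) (σ : Equiv.Perm (Fin (n + 2))),
      (cycleGain c p.1 p.2 z σ : EReal) := by
    ext p; rw [← cyclicalRate_eq]
  rw [h]
  refine lowerSemicontinuous_iSup fun n => lowerSemicontinuous_iSup fun z =>
    lowerSemicontinuous_iSup fun _ => lowerSemicontinuous_iSup fun σ =>
    Continuous.lowerSemicontinuous ?_
  refine continuous_coe_real_ereal.comp ?_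
  have hcons : ∀ j, Continuous fun p : X × Y =>
      (Fin.cons p.2 (fun i => (z i).2) : Fin (n + 2) → Y) j := by
    intro j
    refine Fin.cases ?_ (fun i => ?_) j
    · simpa using continuous_snd
    · simpa using continuous_const
  unfold cycleGain
  refine ((hc.add continuous_const)).sub (Continuous.add ?_ ?_)
  · exact hc.comp (continuous_fst.prodMk (hcons _))
  · exact continuous_finsetSum _ fun i _ => hc.comp (continuous_const.prodMk (hcons _))

/-- Inserting a point `(a, b)` of `Γ` into a cycle. -/
lemma cyclicalRate_le_add {a : X} {b : Y} (hab : (a, b) ∈ Γ) (x : X) (y : Y) :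
    cyclicalRate c Γ (a, y) ≤ cyclicalRate c Γ (x, y) +
      ((c (x, b) - c (x, y) - c (a, b) + c (a, y) : ℝ) : EReal) := by
  refine cyclicalRate_le fun n z hz σ => ?_
  -- In the longer cycle `(x, y), (a, b), z`, the point `x` is matched with `b`, while `a` and the
  -- points of `z` keep the partners that `σ` gave them. `Fin.succAbove 1` skips the column of `b`.
  let σ' : Equiv.Perm (Fin (n + 3)) :=
    (finSuccEquiv' 0).trans ((Equiv.optionCongr σ).trans (finSuccEquiv' 1).symm)
  have h0 : σ' 0 = 1 := by simp [σ']
  have hs : ∀ i : Fin (n + 2), σ' i.succ = Fin.succAbove 1 (σ i) := by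
    intro i
    have : finSuccEquiv' (0 : Fin (n + 3)) i.succ = some i := by
      rw [← Fin.succAbove_zero_apply, finSuccEquiv'_succAbove]
    simp [σ', this]
  have hz' : ∀ i, (Fin.cons (a, b) z : Fin (n + 2) → X × Y) i ∈ Γ := by
    intro i
    refine Fin.cases ?_ (fun i => ?_) i
    · simpa using hab
    · simpa using hz i
  have key : cycleGain c a y z σ =
      cycleGain c x y (Fin.cons (a, b) z : Fin (n + 2) → X × Y) σ' +
        (c (x, b) - c (x, y) - c (a, b) + c (a, y)) := by
    have hY : ∀ j : Fin (n + 2), (Fin.cons y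
        (fun i => ((Fin.cons (a, b) z : Fin (n + 2) → X × Y) i).2) : Fin (n + 3) → Y)
          (Fin.succAbove 1 j) = (Fin.cons y (fun i => (z i).2) : Fin (n + 2) → Y) j := by
      intro j
      refine Fin.cases ?_ (fun i => ?_) j
      · simp
      · rw [← Fin.succ_zero_eq_one, Fin.succ_succAbove_succ]
        simp
    have h1 : (Fin.cons y (fun i => ((Fin.cons (a, b) z : Fin (n + 2) → X × Y) i).2) :
        Fin (n + 3) → Y) 1 = b := by
      rw [← Fin.succ_zero_eq_one, Fin.cons_succ, Fin.cons_zero]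
    unfold cycleGain
    simp only [hs, h0, hY, h1]
    rw [Fin.sum_univ_succ (n := n + 1), Fin.sum_univ_succ (n := n + 1)]
    simp only [Fin.cons_zero, Fin.cons_succ]
    ring
  rw [key, EReal.coe_add]
  exact add_le_add_left (cycleGain_le_cyclicalRate x y hz' σ') _

lemma cyclicalRate_eq_zero (hcm : ∀ p ∈ Γ, cyclicalRate c Γ p ≤ 0) {p : X × Y} (hp : p ∈ Γ) :
    cyclicalRate c Γ p = 0 :=
  le_antisymm (hcm p hp) (cyclicalRate_nonneg ⟨p, hp⟩ p)

/-- Finiteness comes from the insertion inequality based at a point of `Γ` with the same second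
coordinate, where the rate vanishes. -/
lemma exists_cyclicalRate_eq_coe (hcm : ∀ p ∈ Γ, cyclicalRate c Γ p ≤ 0)
    {x : X} {y : Y} (hx : x ∈ Prod.fst '' Γ)
    (hy : y ∈ Prod.snd '' Γ) : ∃ t : ℝ, cyclicalRate c Γ (x, y) = t := by
  obtain ⟨⟨a, b⟩, hab, rfl⟩ := hx
  obtain ⟨⟨x₀, y₀⟩, h0, rfl⟩ := hy
  have h1 := cyclicalRate_le_add (c := c) hab x₀ y₀
  rw [cyclicalRate_eq_zero hcm h0, zero_add] at h1
  have h2 := cyclicalRate_nonneg (c := c) ⟨_, hab⟩ (a, y₀)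
  refine ⟨(cyclicalRate c Γ (a, y₀)).toReal, (EReal.coe_toReal ?_ ?_).symm⟩
  · exact (h1.trans_lt (EReal.coe_lt_top _)).ne
  · exact (EReal.bot_lt_zero.trans_le h2).ne'

/-- The section of the rate function through a point of `Γ` is a Kantorovich potential. -/
lemma isKantorovichPotential_cyclicalRate (hcm : ∀ p ∈ Γ, cyclicalRate c Γ p ≤ 0)
    {x₀ : X} {y₀ : Y} (h0 : (x₀, y₀) ∈ Γ) :
    IsKantorovichPotential c Γ fun x => cyclicalRate c Γ (x, y₀) - (c (x, y₀) : EReal) := by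
  -- The witness `φ` groups cycles by the partner `y` given to `x`: once `c(x, y₀)` is subtracted,
  -- the gain depends on `x` only through `-c(x, y)`.
  refine ⟨⟨fun x hx => ?_, fun y => ⨆ (n : ℕ) (z : Fin (n + 1) → X × Y) (_ : ∀ i, z i ∈ Γ)
    (σ : Equiv.Perm (Fin (n + 2)))
    (_ : (Fin.cons y₀ (fun i => (z i).2) : Fin (n + 2) → Y) (σ 0) = y),
    (((∑ i, c (z i)) - ∑ i : Fin (n + 1),
      c ((z i).1, (Fin.cons y₀ (fun i => (z i).2) : Fin (n + 2) → Y) (σ i.succ)) : ℝ) : EReal),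
    fun x => le_antisymm ?_ ?_⟩, ?_⟩
  · have h1 := cyclicalRate_nonneg (c := c) ⟨_, h0⟩ (x, y₀)
    have h2 := EReal.sub_le_sub h1 (le_refl (c (x, y₀) : EReal))
    have h2 := h2.trans_eq hx
    rw [le_bot_iff, zero_sub, ← EReal.coe_neg] at h2
    exact EReal.coe_ne_bot _ h2
  · rw [EReal.sub_le_iff_le_add (.inl (EReal.coe_ne_bot _)) (.inl (EReal.coe_ne_top _))]
    refine cyclicalRate_le fun n z hz σ => ?_
    set y := (Fin.cons y₀ (fun i => (z i).2) : Fin (n + 2) → Y) (σ 0) with hy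
    set k : ℝ := (∑ i, c (z i)) - ∑ i : Fin (n + 1),
      c ((z i).1, (Fin.cons y₀ (fun i => (z i).2) : Fin (n + 2) → Y) (σ i.succ)) with hk
    have : cycleGain c x y₀ z σ = (k - c (x, y)) + c (x, y₀) := by
      simp only [cycleGain, hk, ← hy]; ring
    rw [this, EReal.coe_add, EReal.coe_sub]
    refine add_le_add_left (le_iSup_of_le y (EReal.sub_le_sub ?_ le_rfl)) _
    exact le_iSup_of_le n (le_iSup_of_le z (le_iSup_of_le hz (le_iSup_of_le σ
      (le_iSup_of_le hy.symm le_rfl))))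
  · refine iSup_le fun y => ?_
    rw [EReal.sub_le_iff_le_add (.inl (EReal.coe_ne_bot _)) (.inl (EReal.coe_ne_top _))]
    refine iSup_le fun n => iSup_le fun z => iSup_le fun hz => iSup_le fun σ =>
      iSup_le fun hy => ?_
    subst hy
    have h1 := cycleGain_le_cyclicalRate (c := c) x y₀ hz σ
    set y := (Fin.cons y₀ (fun i => (z i).2) : Fin (n + 2) → Y) (σ 0) with hy
    set k : ℝ := (∑ i, c (z i)) - ∑ i : Fin (n + 1),
      c ((z i).1, (Fin.cons y₀ (fun i => (z i).2) : Fin (n + 2) → Y) (σ i.succ)) with hk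
    have : k = cycleGain c x y₀ z σ - c (x, y₀) + c (x, y) := by
      simp only [cycleGain, hk, ← hy]; ring
    rw [this, EReal.coe_add, EReal.coe_sub]
    exact add_le_add_left (EReal.sub_le_sub h1 le_rfl) _
  · rintro ⟨a, b⟩ hab
    obtain ⟨t, ht⟩ := exists_cyclicalRate_eq_coe hcm (x := a) (y := y₀) ⟨_, hab, rfl⟩
      ⟨_, h0, rfl⟩
    -- The infimum is attained at `a`; inserting `(a, b)` into cycles shows that no other `x` does
    -- better.
    have hT : cTransform c (fun x => cyclicalRate c Γ (x, y₀) - (c (x, y₀) : EReal)) b =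
        ((t - c (a, y₀) + c (a, b) : ℝ) : EReal) := by
      refine le_antisymm ((iInf_le _ a).trans_eq ?_) (le_iInf fun x => ?_)
      · beta_reduce; rw [ht]; norm_cast
      · beta_reduce
        have h1 := cyclicalRate_le_add (c := c) hab x y₀
        rw [ht] at h1
        rcases eq_or_ne (cyclicalRate c Γ (x, y₀)) ⊤ with htop | htop
        · rw [htop, EReal.top_sub_coe, EReal.top_add_coe]; exact le_top
        · have hb : cyclicalRate c Γ (x, y₀) ≠ ⊥ :=
            (EReal.bot_lt_zero.trans_le (cyclicalRate_nonneg ⟨_, hab⟩ _)).ne'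
          lift cyclicalRate c Γ (x, y₀) to ℝ using ⟨htop, hb⟩ with s
          norm_cast at h1 ⊢
          linarith
    change -(cyclicalRate c Γ (a, y₀) - (c (a, y₀) : EReal)) + cTransform c _ b = (c (a, b) : EReal)
    rw [hT, ht]
    norm_cast
    ring

/-- The sections through `y` and `y'` are potentials, so their difference takes the same value at
`x` and `x'`. The rate vanishes at `(x, y')` and `(x', y)`, and the other two values remain. -/
lemma cyclicalRate_add_cyclicalRate (hcm : ∀ p ∈ Γ, cyclicalRate c Γ p ≤ 0)
    (huniq : UniqueKantorovichPotentials c Γ) {x x' : X} {y y' : Y}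
    (h : (x, y') ∈ Γ) (h' : (x', y) ∈ Γ) :
    cyclicalRate c Γ (x, y) + cyclicalRate c Γ (x', y') =
      ((c (x, y) + c (x', y') - c (x, y') - c (x', y) : ℝ) : EReal) := by
  obtain ⟨r, hr⟩ := huniq _ _ (isKantorovichPotential_cyclicalRate hcm h')
    (isKantorovichPotential_cyclicalRate hcm h)
  have h1 := hr x ⟨_, h, rfl⟩
  have h2 := hr x' ⟨_, h', rfl⟩
  obtain ⟨s, hs⟩ := exists_cyclicalRate_eq_coe hcm (x := x) (y := y) ⟨_, h, rfl⟩ ⟨_, h', rfl⟩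
  obtain ⟨t, ht⟩ := exists_cyclicalRate_eq_coe hcm (x := x') (y := y') ⟨_, h', rfl⟩ ⟨_, h, rfl⟩
  simp only [cyclicalRate_eq_zero hcm h, cyclicalRate_eq_zero hcm h', hs, ht] at h1 h2 ⊢
  norm_cast at h1 h2 ⊢
  linarith

/-- On `X₀`, `ψ` equals the section through `y` up to a constant. Evaluating at a partner `x₀` of
`y` in `Γ`, where the rate is zero, fixes that constant together with `ψ^c(y)`. -/
lemma cyclicalRate_eq_of_isKantorovichPotential (hcm : ∀ p ∈ Γ, cyclicalRate c Γ p ≤ 0)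
    (huniq : UniqueKantorovichPotentials c Γ) {ψ : X → EReal}
    (hψ : IsKantorovichPotential c Γ ψ) {x : X} {y : Y} (hx : x ∈ Prod.fst '' Γ)
    (hy : y ∈ Prod.snd '' Γ) :
    cyclicalRate c Γ (x, y) = (c (x, y) : EReal) - (-ψ x + cTransform c ψ y) := by
  obtain ⟨t, ht⟩ := exists_cyclicalRate_eq_coe hcm hx hy
  obtain ⟨⟨x₀, y⟩, h0, rfl⟩ := hy
  obtain ⟨r, hr⟩ := huniq _ _ hψ (isKantorovichPotential_cyclicalRate hcm h0)
  have h1 := hr x hx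
  have h2 := hr x₀ ⟨_, h0, rfl⟩
  have h3 : -ψ x₀ + cTransform c ψ y = (c (x₀, y) : EReal) := hψ.2 h0
  simp only [cyclicalRate_eq_zero hcm h0, ht] at h1 h2 ⊢
  have lift_coe : ∀ {w : EReal} {s : ℝ}, w - (s : EReal) = (r : EReal) →
      w = ((r + s : ℝ) : EReal) := by
    intro w s h
    induction w with
    | bot => simp at h
    | top => simp at h
    | coe w => norm_cast at h ⊢; linarith
  norm_cast at h1 h2
  have e1 := lift_coe h1
  have e2 := lift_coe h2
  rw [e2] at h3
  rw [e1]
  have e3 : cTransform c ψ y = ((c (x₀, y) + (r + (0 - c (x₀, y))) : ℝ) : EReal) := by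
    revert h3
    induction cTransform c ψ y with
    | bot => intro h; simp at h
    | top => intro h; rw [← EReal.coe_neg, EReal.coe_add_top] at h; simp at h
    | coe w => intro h; norm_cast at h ⊢; linarith
  rw [e3]
  norm_cast
  ring

end RateFunction

/-! ### Approximate cyclical invariance -/

section CycleBound

variable {X Y : Type*} [MeasurableSpace X] [MeasurableSpace Y]

/-- `π` has the density `u(x) v(y) exp(-C(x, y) / η)` with respect to `μ × ν`. -/
def HasProductForm (μ : ProbabilityMeasure X) (ν : ProbabilityMeasure Y) (C : X × Y → ℝ) (η : ℝ)
    (π : ProbabilityMeasure (X × Y)) : Prop :=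
  ∃ (u : X → ℝ≥0∞) (v : Y → ℝ≥0∞), Measurable u ∧ Measurable v ∧
    (π : Measure (X × Y)) = ((μ : Measure X).prod (ν : Measure Y)).withDensity
      fun z => u z.1 * v z.2 * ENNReal.ofReal (Real.exp (-C z / η))

variable {μ : ProbabilityMeasure X} {ν : ProbabilityMeasure Y} {C : X × Y → ℝ} {η : ℝ}
  {π : ProbabilityMeasure (X × Y)}

/-- Approximate cyclical invariance on rectangles where the cost is nearly constant. -/
lemma HasProductForm.prod_rectangles_le (h : HasProductForm μ ν C η π) (hη : 0 < η) {ι : Type*}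
    [Fintype ι] {A : ι → Set X} {B : ι → Set Y} (hA : ∀ i, MeasurableSet (A i))
    (hB : ∀ i, MeasurableSet (B i)) {d : ι → ι → ℝ} {δ : ℝ}
    (hd : ∀ i j, ∀ a ∈ A i, ∀ b ∈ B j, |C (a, b) - d i j| ≤ δ) (σ : Equiv.Perm ι) :
    ∏ i, (π : Measure (X × Y)) (A i ×ˢ B i) ≤
      ENNReal.ofReal (Real.exp ((∑ i, d i (σ i) - ∑ i, d i i + 2 * Fintype.card ι * δ) / η)) *
        ∏ i, (π : Measure (X × Y)) (A i ×ˢ B (σ i)) := by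
  obtain ⟨u, v, hu, hv, hπ⟩ := h
  have hb := fun i j => rectangle_bounds hη hu hv hπ (hA i) (hB j) (hd i j)
  set P : ι → ℝ≥0∞ := fun i => ∫⁻ x in A i, u x ∂(μ : Measure X)
  set Q : ι → ℝ≥0∞ := fun i => ∫⁻ y in B i, v y ∂(ν : Measure Y)
  have h2 : ∀ i, P i * Q (σ i) ≤ ENNReal.ofReal (Real.exp ((d i (σ i) + δ) / η)) *
      (π : Measure (X × Y)) (A i ×ˢ B (σ i)) := by
    intro i
    have := mul_le_mul_right (hb i (σ i)).1 (ENNReal.ofReal (Real.exp ((d i (σ i) + δ) / η)))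
    rwa [← mul_assoc, ← ENNReal.ofReal_mul (Real.exp_pos _).le, ← Real.exp_add, neg_div,
      add_neg_cancel, Real.exp_zero, ENNReal.ofReal_one, one_mul] at this
  calc ∏ i, (π : Measure (X × Y)) (A i ×ˢ B i)
      ≤ ∏ i, ENNReal.ofReal (Real.exp (-(d i i - δ) / η)) * (P i * Q i) :=
        Finset.prod_le_prod' fun i _ => (hb i i).2
    -- The product structure is used here: reindexing the `Q` factors by `σ` costs nothing.
    _ = (∏ i, ENNReal.ofReal (Real.exp (-(d i i - δ) / η))) * ∏ i, (P i * Q (σ i)) := by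
        rw [Finset.prod_mul_distrib, Finset.prod_mul_distrib, Finset.prod_mul_distrib,
          Equiv.prod_comp σ Q]
    _ ≤ (∏ i, ENNReal.ofReal (Real.exp (-(d i i - δ) / η))) *
        ∏ i, (ENNReal.ofReal (Real.exp ((d i (σ i) + δ) / η)) *
          (π : Measure (X × Y)) (A i ×ˢ B (σ i))) := by
        exact mul_le_mul' le_rfl (Finset.prod_le_prod' fun i _ => h2 i)
    _ = _ := by
        rw [Finset.prod_mul_distrib, ← mul_assoc, ← Finset.prod_mul_distrib]
        simp_rw [← ENNReal.ofReal_mul (Real.exp_pos _).le, ← Real.exp_add]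
        rw [← ENNReal.ofReal_prod_of_nonneg fun i _ => (Real.exp_pos _).le, ← Real.exp_sum]
        congr 3
        simp_rw [← add_div]
        rw [← Finset.sum_div]
        congr 1
        simp only [Finset.sum_add_distrib, Finset.sum_neg_distrib, Finset.sum_sub_distrib,
          Finset.sum_const, Finset.card_univ, nsmul_eq_mul]
        ring

end CycleBound

/-! ### Exponential estimates near a point -/

section Asymptotics

/-- Absorbs constants independent of `η` into an arbitrarily small loss in the exponent. -/
lemma eventually_le_exp_div {K : ℝ} (hK : 0 < K) {L : ℝ≥0∞} (hL : L ≠ ⊤) :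
    ∀ᶠ η : ℝ in 𝓝[>] 0, L ≤ ENNReal.ofReal (Real.exp (K / η)) := by
  have h : Tendsto (fun η : ℝ => Real.exp (K / η)) (𝓝[>] 0) atTop := by
    have h0 : Tendsto (fun η : ℝ => K / η) (𝓝[>] 0) atTop := by
      simpa only [div_eq_mul_inv] using tendsto_inv_nhdsGT_zero.const_mul_atTop hK
    exact Real.tendsto_exp_atTop.comp h0
  filter_upwards [h.eventually_ge_atTop L.toReal] with η hη
  exact (ENNReal.le_ofReal_iff_toReal_le hL (Real.exp_pos _).le).2 hη

lemma exp_div_mul_exp_div (a b η : ℝ) :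
    ENNReal.ofReal (Real.exp (a / η)) * ENNReal.ofReal (Real.exp (b / η)) =
      ENNReal.ofReal (Real.exp ((a + b) / η)) := by
  rw [← ENNReal.ofReal_mul (Real.exp_pos _).le, ← Real.exp_add, add_div]

lemma coe_mul_log_exp_div {η : ℝ} (hη : 0 < η) (r : ℝ) :
    (η : EReal) * ENNReal.log (ENNReal.ofReal (Real.exp (r / η))) = r := by
  rw [ENNReal.log_ofReal_of_pos (Real.exp_pos _), Real.log_exp, ← EReal.coe_mul,
    mul_div_cancel₀ _ hη.ne']

variable {X Y : Type*} [TopologicalSpace X] [TopologicalSpace Y]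

lemma exists_open_rectangles {ι : Type*} [Finite ι] {x : ι → X} {y : ι → Y}
    {V : ι → ι → Set (X × Y)} (hV : ∀ i j, V i j ∈ 𝓝 (x i, y j)) :
    ∃ (A : ι → Set X) (B : ι → Set Y), (∀ i, IsOpen (A i)) ∧ (∀ i, IsOpen (B i)) ∧
      (∀ i, x i ∈ A i) ∧ (∀ i, y i ∈ B i) ∧ ∀ i j, A i ×ˢ B j ⊆ V i j := by
  choose A B hA hxA hB hyB hAB using fun i j => mem_nhds_prod_iff'.1 (hV i j)
  refine ⟨fun i => ⋂ j, A i j, fun j => ⋂ i, B i j, fun i => isOpen_iInter_of_finite (hA i),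
    fun j => isOpen_iInter_of_finite fun i => hB i j, fun i => Set.mem_iInter.2 (hxA i),
    fun j => Set.mem_iInter.2 fun i => hyB i j, fun i j => ?_⟩
  exact (Set.prod_mono (Set.iInter_subset _ j) (Set.iInter_subset _ i)).trans (hAB i j)

variable [MeasurableSpace X] [BorelSpace X] [MeasurableSpace Y] [BorelSpace Y]
  {μ : ProbabilityMeasure X} {ν : ProbabilityMeasure Y}
  {c : X × Y → ℝ} {cη : ℝ → X × Y → ℝ} {πη : ℝ → ProbabilityMeasure (X × Y)}
  {π : ProbabilityMeasure (X × Y)}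

lemma eventually_prod_rectangles_le (hc : Continuous c) (hunif : TendstoUniformly cη c (𝓝[>] 0))
    (hform : ∀ᶠ η in 𝓝[>] 0, HasProductForm μ ν (cη η) η (πη η)) {ι : Type*} [Fintype ι]
    (x : ι → X) (y : ι → Y) {V : ι → ι → Set (X × Y)} (hV : ∀ i j, V i j ∈ 𝓝 (x i, y j))
    (σ : Equiv.Perm ι) {t : ℝ} (ht : ∑ i, c (x i, y (σ i)) - ∑ i, c (x i, y i) < t) :
    ∃ (A : ι → Set X) (B : ι → Set Y), (∀ i, IsOpen (A i)) ∧ (∀ i, IsOpen (B i)) ∧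
      (∀ i, x i ∈ A i) ∧ (∀ i, y i ∈ B i) ∧ (∀ i j, A i ×ˢ B j ⊆ V i j) ∧
      ∀ᶠ η in 𝓝[>] 0, ∏ i, (πη η : Measure (X × Y)) (A i ×ˢ B i) ≤
        ENNReal.ofReal (Real.exp (t / η)) *
          ∏ i, (πη η : Measure (X × Y)) (A i ×ˢ B (σ i)) := by
  set D := ∑ i, c (x i, y (σ i)) - ∑ i, c (x i, y i) with hD
  -- Continuity and uniform convergence each cost `δ`, so the rectangle bound loses `4 * card ι *
  -- δ`, less than `t - D`. The `+ 1` covers an empty index type.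
  set δ : ℝ := (t - D) / (4 * (Fintype.card ι + 1)) with hδ
  have hδ0 : 0 < δ := by have := sub_pos.2 ht; positivity
  have hW : ∀ i j, V i j ∩ {z | |c z - c (x i, y j)| < δ} ∈ 𝓝 (x i, y j) := by
    intro i j
    refine inter_mem (hV i j) ?_
    have := Metric.continuousAt_iff'.1 (hc.continuousAt (x := (x i, y j))) δ hδ0
    simp only [Real.dist_eq] at this
    exact this
  obtain ⟨A, B, hA, hB, hxA, hyB, hAB⟩ := exists_open_rectangles hW
  refine ⟨A, B, hA, hB, hxA, hyB, fun i j => (hAB i j).trans Set.inter_subset_left, ?_⟩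
  filter_upwards [hform, self_mem_nhdsWithin, Metric.tendstoUniformly_iff.1 hunif δ hδ0]
    with η hη hη0 hηδ
  have hd : ∀ i j, ∀ a ∈ A i, ∀ b ∈ B j, |cη η (a, b) - c (x i, y j)| ≤ 2 * δ := by
    intro i j a ha b hb
    have h1 : |c (a, b) - c (x i, y j)| < δ := (hAB i j ⟨ha, hb⟩).2
    have h2 := hηδ (a, b)
    rw [dist_comm, Real.dist_eq] at h2
    calc |cη η (a, b) - c (x i, y j)|
        ≤ |cη η (a, b) - c (a, b)| + |c (a, b) - c (x i, y j)| := abs_sub_le _ _ _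
      _ ≤ 2 * δ := by linarith
  refine (hη.prod_rectangles_le hη0 (fun i => (hA i).measurableSet)
    (fun i => (hB i).measurableSet) hd σ).trans ?_
  have hη0 : 0 < η := hη0
  gcongr
  rw [← hD]
  have : δ * (4 * (Fintype.card ι + 1)) = t - D := by
    rw [hδ]; field_simp
  nlinarith

variable [PolishSpace X] [PolishSpace Y]

/-- The portmanteau theorem for open sets; half of `π(U) > 0` leaves room for the liminf. -/
lemma exists_eventually_le_measure (hπ : Tendsto πη (𝓝[>] 0) (𝓝 π)) {U : Set (X × Y)}
    (hU : IsOpen U) {p : X × Y} (hpU : p ∈ U) (hp : p ∈ (π : Measure (X × Y)).support) :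
    ∃ L : ℝ≥0∞, L ≠ 0 ∧ L ≠ ⊤ ∧ ∀ᶠ η in 𝓝[>] 0, L ≤ (πη η : Measure (X × Y)) U := by
  have hpos := (Measure.mem_support_iff_forall p).1 hp U (hU.mem_nhds hpU)
  have hfin : (π : Measure (X × Y)) U ≠ ⊤ := measure_ne_top _ _
  refine ⟨(π : Measure (X × Y)) U / 2, (ENNReal.half_pos hpos.ne').ne',
    ((ENNReal.half_le_self).trans_lt hfin.lt_top).ne, ?_⟩
  have h := (ENNReal.half_lt_self hpos.ne' hfin).trans_le
    (ProbabilityMeasure.le_liminf_measure_open_of_tendsto hπ hU)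
  exact (eventually_lt_of_lt_liminf h).mono fun η hη => hη.le

/-- Local upper bound at a point. -/
lemma exists_nhds_eventually_measure_le (hc : Continuous c)
    (hunif : TendstoUniformly cη c (𝓝[>] 0))
    (hform : ∀ᶠ η in 𝓝[>] 0, HasProductForm μ ν (cη η) η (πη η))
    (hπ : Tendsto πη (𝓝[>] 0) (𝓝 π)) {p : X × Y} {r : ℝ}
    (hr : (r : EReal) < cyclicalRate c (π : Measure (X × Y)).support p) :
    ∃ V ∈ 𝓝 p, ∀ᶠ η in 𝓝[>] 0,
      (πη η : Measure (X × Y)) V ≤ ENNReal.ofReal (Real.exp (-r / η)) := by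
  simp only [cyclicalRate, lt_iSup_iff] at hr
  obtain ⟨n, z, hz, σ, hr⟩ := hr
  rw [EReal.coe_lt_coe_iff] at hr
  set w : Fin (n + 2) → X × Y := Fin.cons p z with hw
  -- The gap between `s` and the gain pays for shrinking to rectangles; the gap between `r` and `s`
  -- pays for dividing by the masses of the support rectangles.
  obtain ⟨s, hs1, hs2⟩ := exists_between hr
  obtain ⟨A, B, hA, hB, hxA, hyB, -, hAB⟩ := eventually_prod_rectangles_le hc hunif hform
    (fun i => (w i).1) (fun i => (w i).2) (V := fun _ _ => Set.univ) (fun _ _ => univ_mem) σ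
    (t := -s) (by simp only [Prod.mk.eta]; linarith)
  have hopen : ∀ i, IsOpen (A i ×ˢ B i) := fun i => (hA i).prod (hB i)
  have hmem : ∀ i, w i ∈ A i ×ˢ B i := fun i => ⟨hxA i, hyB i⟩
  have hL : ∀ i : Fin (n + 1), ∃ L : ℝ≥0∞, L ≠ 0 ∧ L ≠ ⊤ ∧ ∀ᶠ η in 𝓝[>] 0,
      L ≤ (πη η : Measure (X × Y)) (A i.succ ×ˢ B i.succ) := by
    intro i
    refine exists_eventually_le_measure hπ (hopen _) (hmem _) ?_
    simpa [hw] using hz i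
  choose L hL0 hLt hL using hL
  have hΛ0 : ∏ i, L i ≠ 0 := Finset.prod_ne_zero_iff.2 fun i _ => hL0 i
  have hΛt : ∏ i, L i ≠ ⊤ := ENNReal.prod_ne_top fun i _ => hLt i
  refine ⟨A 0 ×ˢ B 0, (hopen 0).mem_nhds (hmem 0), ?_⟩
  filter_upwards [hAB, eventually_all.2 hL,
    eventually_le_exp_div (sub_pos.2 hs1) (ENNReal.inv_ne_top.2 hΛ0)] with η h1 h2 h3
  rw [Fin.prod_univ_succ] at h1
  have h4 : (πη η : Measure (X × Y)) (A 0 ×ˢ B 0) * ∏ i, L i ≤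
      ENNReal.ofReal (Real.exp (-s / η)) := by
    calc (πη η : Measure (X × Y)) (A 0 ×ˢ B 0) * ∏ i, L i
        ≤ (πη η : Measure (X × Y)) (A 0 ×ˢ B 0) *
          ∏ i : Fin (n + 1), (πη η : Measure (X × Y)) (A i.succ ×ˢ B i.succ) := by
          gcongr with i
          exact h2 i
      _ ≤ _ := h1
      _ ≤ ENNReal.ofReal (Real.exp (-s / η)) * 1 := by
          gcongr
          exact Finset.prod_le_one' fun i _ => prob_le_one
      _ = _ := mul_one _
  calc (πη η : Measure (X × Y)) (A 0 ×ˢ B 0)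
      = (πη η : Measure (X × Y)) (A 0 ×ˢ B 0) * (∏ i, L i) * (∏ i, L i)⁻¹ := by
        rw [mul_assoc, ENNReal.mul_inv_cancel hΛ0 hΛt, mul_one]
    _ ≤ ENNReal.ofReal (Real.exp (-s / η)) * ENNReal.ofReal (Real.exp ((s - r) / η)) := by
        gcongr
    _ = ENNReal.ofReal (Real.exp (-r / η)) := by
        rw [exp_div_mul_exp_div]; congr 3; ring

/-- The support of the limit is cyclically monotone. -/
lemma cyclicalRate_nonpos_of_mem_support (hc : Continuous c)
    (hunif : TendstoUniformly cη c (𝓝[>] 0))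
    (hform : ∀ᶠ η in 𝓝[>] 0, HasProductForm μ ν (cη η) η (πη η))
    (hπ : Tendsto πη (𝓝[>] 0) (𝓝 π)) {p : X × Y}
    (hp : p ∈ (π : Measure (X × Y)).support) :
    cyclicalRate c (π : Measure (X × Y)).support p ≤ 0 := by
  by_contra hlt
  obtain ⟨r, hr0, hr⟩ := EReal.lt_iff_exists_real_btwn.1 (not_le.1 hlt)
  have hr0 : 0 < r := by exact_mod_cast hr0
  obtain ⟨V, hV, hVle⟩ := exists_nhds_eventually_measure_le hc hunif hform hπ hr
  obtain ⟨U, hUV, hU, hpU⟩ := mem_nhds_iff.1 hV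
  obtain ⟨L, hL0, hLt, hL⟩ := exists_eventually_le_measure hπ hU hpU hp
  -- Multiplying `L ≤ exp(-r / η)` by `2 / L ≤ exp(r / η)` yields `2 ≤ 1`.
  have h2L : 2 * L⁻¹ ≠ ⊤ := ENNReal.mul_ne_top (by simp) (ENNReal.inv_ne_top.2 hL0)
  obtain ⟨η, h1, h2, h3⟩ := (hVle.and (hL.and (eventually_le_exp_div hr0 h2L))).exists
  have h4 : L ≤ ENNReal.ofReal (Real.exp (-r / η)) := h2.trans ((measure_mono hUV).trans h1)
  have h5 : L * (2 * L⁻¹) ≤ 1 := by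
    refine (mul_le_mul' h4 h3).trans ?_
    rw [exp_div_mul_exp_div]
    simp
  rw [mul_left_comm, ENNReal.mul_inv_cancel hL0 hLt, mul_one] at h5
  exact absurd h5 (by norm_num)

/-- Local lower bound at a point of the product of the projections of the support. -/
lemma eventually_le_measure_of_isOpen (hc : Continuous c)
    (hunif : TendstoUniformly cη c (𝓝[>] 0))
    (hform : ∀ᶠ η in 𝓝[>] 0, HasProductForm μ ν (cη η) η (πη η))
    (hπ : Tendsto πη (𝓝[>] 0) (𝓝 π))
    (huniq : UniqueKantorovichPotentials c (π : Measure (X × Y)).support)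
    {U : Set (X × Y)} (hU : IsOpen U) {x x' : X} {y y' : Y} (hxy : (x, y) ∈ U)
    (h : (x, y') ∈ (π : Measure (X × Y)).support) (h' : (x', y) ∈ (π : Measure (X × Y)).support)
    {r : ℝ} (hr : cyclicalRate c (π : Measure (X × Y)).support (x, y) < r) :
    ∀ᶠ η in 𝓝[>] 0, ENNReal.ofReal (Real.exp (-r / η)) ≤ (πη η : Measure (X × Y)) U := by
  set Γ := (π : Measure (X × Y)).support with hΓ
  have hcm : ∀ p ∈ Γ, cyclicalRate c Γ p ≤ 0 := fun p hp =>
    cyclicalRate_nonpos_of_mem_support hc hunif hform hπ hp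
  obtain ⟨t, ht⟩ := exists_cyclicalRate_eq_coe hcm (x := x) (y := y) ⟨_, h, rfl⟩ ⟨_, h', rfl⟩
  obtain ⟨t', ht'⟩ := exists_cyclicalRate_eq_coe hcm (x := x') (y := y') ⟨_, h', rfl⟩ ⟨_, h, rfl⟩
  have hsum := cyclicalRate_add_cyclicalRate hcm huniq h h'
  rw [ht, ht'] at hsum
  rw [ht, EReal.coe_lt_coe_iff] at hr
  norm_cast at hsum
  -- One `ε` each for the four-cycle estimate, the upper bound at `(x', y')`, and the constant `L₀ *
  -- L₁`.
  set ε := (r - t) / 3 with hε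
  have hε0 : 0 < ε := by have := sub_pos.2 hr; positivity
  obtain ⟨W, hW, hWle⟩ := exists_nhds_eventually_measure_le hc hunif hform hπ (p := (x', y'))
    (r := t' - ε) (by rw [← hΓ, ht', EReal.coe_lt_coe_iff]; linarith)
  -- the points `(x, y')`, `(x', y)` are exchanged into `(x, y)`, `(x', y')`
  obtain ⟨A, B, hA, hB, hxA, hyB, hsub, hAB⟩ := eventually_prod_rectangles_le hc hunif hform
    ![x, x'] ![y', y] (V := ![![Set.univ, U], ![W, Set.univ]])
    (by
      intro i j
      fin_cases i <;> fin_cases j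
      · exact univ_mem
      · exact hU.mem_nhds hxy
      · exact hW
      · exact univ_mem) (Equiv.swap 0 1) (t := t + t' + ε)
    (by
      simp only [Fin.sum_univ_two, Equiv.swap_apply_left, Equiv.swap_apply_right]
      simp only [Matrix.cons_val_zero, Matrix.cons_val_one]
      linarith)
  simp only [Fin.prod_univ_two, Equiv.swap_apply_left, Equiv.swap_apply_right] at hAB
  obtain ⟨L₀, h00, h0t, hL₀⟩ := exists_eventually_le_measure hπ ((hA 0).prod (hB 0))
    (p := (x, y')) ⟨hxA 0, hyB 0⟩ h
  obtain ⟨L₁, h10, h1t, hL₁⟩ := exists_eventually_le_measure hπ ((hA 1).prod (hB 1))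
    (p := (x', y)) ⟨hxA 1, hyB 1⟩ h'
  have hΛ0 : L₀ * L₁ ≠ 0 := mul_ne_zero h00 h10
  have hΛt : L₀ * L₁ ≠ ⊤ := ENNReal.mul_ne_top h0t h1t
  filter_upwards [hAB, hL₀, hL₁, hWle, eventually_le_exp_div hε0 (ENNReal.inv_ne_top.2 hΛ0)]
    with η h1 h2 h3 h4 h5
  have hU01 : (πη η : Measure (X × Y)) (A 0 ×ˢ B 1) ≤ (πη η : Measure (X × Y)) U :=
    measure_mono (hsub 0 1)
  have hW10 : (πη η : Measure (X × Y)) (A 1 ×ˢ B 0) ≤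
      ENNReal.ofReal (Real.exp (-(t' - ε) / η)) := (measure_mono (hsub 1 0)).trans h4
  have h6 : L₀ * L₁ ≤ ENNReal.ofReal (Real.exp ((t + 2 * ε) / η)) *
      (πη η : Measure (X × Y)) U := by
    calc L₀ * L₁ ≤ _ := mul_le_mul' h2 h3
      _ ≤ _ := h1
      _ ≤ ENNReal.ofReal (Real.exp ((t + t' + ε) / η)) * ((πη η : Measure (X × Y)) U *
          ENNReal.ofReal (Real.exp (-(t' - ε) / η))) := by gcongr
      _ = (ENNReal.ofReal (Real.exp ((t + t' + ε) / η)) *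
          ENNReal.ofReal (Real.exp (-(t' - ε) / η))) * (πη η : Measure (X × Y)) U := by ring
      _ = _ := by rw [exp_div_mul_exp_div]; congr 4; ring
  have h7 : 1 ≤ ENNReal.ofReal (Real.exp (r / η)) * (πη η : Measure (X × Y)) U := by
    calc 1 = (L₀ * L₁)⁻¹ * (L₀ * L₁) := (ENNReal.inv_mul_cancel hΛ0 hΛt).symm
      _ ≤ ENNReal.ofReal (Real.exp (ε / η)) * (ENNReal.ofReal (Real.exp ((t + 2 * ε) / η)) *
          (πη η : Measure (X × Y)) U) := mul_le_mul' h5 h6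
      _ = _ := by
        rw [← mul_assoc, exp_div_mul_exp_div]
        congr 4
        rw [hε]; ring
  calc ENNReal.ofReal (Real.exp (-r / η)) = ENNReal.ofReal (Real.exp (-r / η)) * 1 := by
        rw [mul_one]
    _ ≤ ENNReal.ofReal (Real.exp (-r / η)) * (ENNReal.ofReal (Real.exp (r / η)) *
          (πη η : Measure (X × Y)) U) := by gcongr
    _ = (πη η : Measure (X × Y)) U := by
      rw [← mul_assoc, exp_div_mul_exp_div, neg_add_cancel]
      simp

/-- The image of a set of full measure in a Polish space has full measure for the image
measure, without any measurability. -/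
lemma image_mem_ae_map {Ω S : Type*} [TopologicalSpace Ω] [PolishSpace Ω] [MeasurableSpace Ω]
    [BorelSpace Ω] [TopologicalSpace S] [T2Space S] [MeasurableSpace S] [BorelSpace S]
    {ρ : Measure Ω} [IsFiniteMeasure ρ] {f : Ω → S} (hf : Continuous f) {F : Set Ω}
    (hF : MeasurableSet F) (hFae : F ∈ ae ρ) : f '' F ∈ ae (ρ.map f) := by
  rw [mem_ae_iff]
  refine le_antisymm (ENNReal.le_of_forall_pos_le_add fun ε hε _ => ?_) bot_le
  -- Inner regularity replaces `F` by a compact set, whose image is compact and hence measurable.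
  obtain ⟨K, hKF, hK, hlt⟩ := hF.exists_isCompact_sdiff_lt (μ := ρ) (measure_ne_top _ _)
    (ε := (ε : ℝ≥0∞)) (by exact_mod_cast hε.ne')
  have hKm : MeasurableSet (f '' K) := (hK.image hf).measurableSet
  calc ρ.map f (f '' F)ᶜ ≤ ρ.map f (f '' K)ᶜ :=
        measure_mono (Set.compl_subset_compl.2 (Set.image_mono hKF))
    _ = ρ (f ⁻¹' (f '' K)ᶜ) := Measure.map_apply hf.measurable hKm.compl
    _ ≤ ρ (Fᶜ ∪ (F \ K)) := by
        refine measure_mono fun ω hω => ?_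
        by_cases h : ω ∈ F
        · exact .inr ⟨h, fun hωK => hω ⟨ω, hωK, rfl⟩⟩
        · exact .inl h
    _ ≤ ρ Fᶜ + ρ (F \ K) := measure_union_le _ _
    _ ≤ 0 + ε := by
        rw [mem_ae_iff.1 hFae, zero_add, zero_add]; exact hlt.le

end Asymptotics

/-! ### The large deviation bounds -/

section LargeDeviations

variable {X Y : Type*} [MeasurableSpace X] [MeasurableSpace Y]
  {μ : ProbabilityMeasure X} {ν : ProbabilityMeasure Y}
  {c : X × Y → ℝ} {cη : ℝ → X × Y → ℝ} {πη : ℝ → ProbabilityMeasure (X × Y)}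
  {π : ProbabilityMeasure (X × Y)}

/-- Once `c_η` is within `1` of `c`, it is bounded below by `a + b - 1`, which is integrable under
any coupling; this supplies the finite negative part needed for the Gibbs form. -/
lemma eventually_hasProductForm
    (hlow : ∃ (a : X → ℝ) (b : Y → ℝ), Integrable a (μ : Measure X) ∧
      Integrable b (ν : Measure Y) ∧ ∀ x y, a x + b y ≤ c (x, y))
    (hcη : ∀ η > 0, Measurable (cη η)) (hunif : TendstoUniformly cη c (𝓝[>] 0))
    (hfin : ∀ η > 0, ∃ π' ∈ Couplings μ ν, entropicCost μ ν (cη η) η π' < ⊤)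
    (hmin : ∀ η > 0, IsEntropicMinimizer μ ν (cη η) η (πη η)) :
    ∀ᶠ η in 𝓝[>] 0, HasProductForm μ ν (cη η) η (πη η) := by
  obtain ⟨a, b, ha, hb, hab⟩ := hlow
  filter_upwards [self_mem_nhdsWithin, Metric.tendstoUniformly_iff.1 hunif 1 one_pos]
    with η hη hdist
  obtain ⟨π', hπ', hlt⟩ := hfin η hη
  refine exists_product_density hη (hcη η hη) (hmin η hη) ?_ (((hmin η hη).2 π' hπ').trans_lt hlt)
  have ia : Integrable (fun z : X × Y => a z.1) (πη η : Measure (X × Y)) :=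
    Integrable.comp_measurable (by rwa [(hmin η hη).1.1]) measurable_fst
  have ib : Integrable (fun z : X × Y => b z.2) (πη η : Measure (X × Y)) :=
    Integrable.comp_measurable (by rwa [(hmin η hη).1.2]) measurable_snd
  have i : Integrable (fun z : X × Y => 1 - (a z.1 + b z.2)) (πη η : Measure (X × Y)) :=
    (integrable_const 1).sub (ia.add ib)
  refine ((lintegral_mono fun z => ENNReal.ofReal_le_ofReal ?_).trans_lt i.lintegral_lt_top).ne
  have h1 := hdist z
  rw [Real.dist_eq, abs_lt] at h1
  have h2 := hab z.1 z.2
  simp only [Prod.mk.eta] at h2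
  linarith [h1.2]

variable [TopologicalSpace X] [PolishSpace X] [BorelSpace X]
  [TopologicalSpace Y] [PolishSpace Y] [BorelSpace Y]

lemma limsup_measure_isCompact_le (hc : Continuous c)
    (hunif : TendstoUniformly cη c (𝓝[>] 0))
    (hform : ∀ᶠ η in 𝓝[>] 0, HasProductForm μ ν (cη η) η (πη η))
    (hπ : Tendsto πη (𝓝[>] 0) (𝓝 π)) {K : Set (X × Y)} (hK : IsCompact K) :
    limsup (fun η : ℝ => (η : EReal) * ENNReal.log ((πη η : Measure (X × Y)) K)) (𝓝[>] 0) ≤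
      -(⨅ p ∈ K, cyclicalRate c (π : Measure (X × Y)).support p) := by
  rw [EReal.le_neg]
  refine EReal.ge_of_forall_gt_iff_ge.1 fun r hr => ?_
  rw [EReal.le_neg]
  -- The local bounds hold with exponent `s`; the gap to `r` absorbs the constant `L` of the finite
  -- cover.
  obtain ⟨s, hrs, hs⟩ := EReal.lt_iff_exists_real_btwn.1 hr
  have hrs : r < s := by exact_mod_cast hrs
  have hcov : ∃ L : ℝ≥0∞, L ≠ ⊤ ∧ ∀ᶠ η in 𝓝[>] 0,
      (πη η : Measure (X × Y)) K ≤ L * ENNReal.ofReal (Real.exp (-s / η)) := by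
    refine hK.induction_on (p := fun S => ∃ L : ℝ≥0∞, L ≠ ⊤ ∧ ∀ᶠ η in 𝓝[>] 0,
      (πη η : Measure (X × Y)) S ≤ L * ENNReal.ofReal (Real.exp (-s / η))) ?_ ?_ ?_ ?_
    · exact ⟨0, by simp, by simp⟩
    · rintro S T hST ⟨L, hL, h⟩
      exact ⟨L, hL, h.mono fun η hη => (measure_mono hST).trans hη⟩
    · rintro S T ⟨L, hL, h⟩ ⟨L', hL', h'⟩
      refine ⟨L + L', ENNReal.add_ne_top.2 ⟨hL, hL'⟩, ?_⟩
      filter_upwards [h, h'] with η h1 h2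
      rw [add_mul]
      exact (measure_union_le _ _).trans (add_le_add h1 h2)
    · intro p hp
      obtain ⟨V, hV, h⟩ := exists_nhds_eventually_measure_le hc hunif hform hπ
        (hs.trans_le (iInf₂_le p hp))
      exact ⟨V, mem_nhdsWithin_of_mem_nhds hV, 1, by simp, by simpa using h⟩
  obtain ⟨L, hL, h⟩ := hcov
  refine limsup_le_of_le (by isBoundedDefault) ?_
  filter_upwards [h, eventually_le_exp_div (sub_pos.2 hrs) hL, self_mem_nhdsWithin]
    with η h1 h2 hη
  have h3 : (πη η : Measure (X × Y)) K ≤ ENNReal.ofReal (Real.exp (-r / η)) := by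
    refine h1.trans ((mul_le_mul' h2 le_rfl).trans_eq ?_)
    rw [exp_div_mul_exp_div]
    congr 3
    ring
  rw [← EReal.coe_neg, ← coe_mul_log_exp_div hη (-r)]
  exact mul_le_mul_of_nonneg_left (ENNReal.log_le_log h3) (EReal.coe_nonneg.2 (le_of_lt hη))

/-- The projections of the support need not be Borel, but they have full measure for `μ` and `ν`,
hence their product has full measure for every coupling. Relatively open sets can thus be replaced
by open ones. -/
lemma measure_inter_prod_eq {ρ : ProbabilityMeasure (X × Y)} (hπ : π ∈ Couplings μ ν)
    (hρ : ρ ∈ Couplings μ ν) (U : Set (X × Y)) :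
    (ρ : Measure (X × Y)) (U ∩ (Prod.fst '' (π : Measure (X × Y)).support) ×ˢ
      (Prod.snd '' (π : Measure (X × Y)).support)) = (ρ : Measure (X × Y)) U := by
  have hm : MeasurableSet (π : Measure (X × Y)).support := Measure.isClosed_support.measurableSet
  have h1 := image_mem_ae_map continuous_fst hm
    (Measure.support_mem_ae (μ := (π : Measure (X × Y))))
  have h2 := image_mem_ae_map continuous_snd hm
    (Measure.support_mem_ae (μ := (π : Measure (X × Y))))
  rw [hπ.1, ← hρ.1] at h1
  rw [hπ.2, ← hρ.2] at h2
  have h1' := ae_of_ae_map measurable_fst.aemeasurable h1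
  have h2' := ae_of_ae_map measurable_snd.aemeasurable h2
  refine measure_congr ?_
  filter_upwards [h1', h2'] with z hz1 hz2
  exact propext ⟨fun h => h.1, fun h => ⟨h, hz1, hz2⟩⟩

/-- Marginals depend continuously on the measure, and weak limits are unique. -/
lemma couplings_of_tendsto (hmem : ∀ η > 0, πη η ∈ Couplings μ ν)
    (hπ : Tendsto πη (𝓝[>] 0) (𝓝 π)) : π ∈ Couplings μ ν := by
  have h1 := ((ProbabilityMeasure.continuous_map
    (continuous_fst (X := X) (Y := Y))).tendsto π).comp hπ
  have h2 := ((ProbabilityMeasure.continuous_map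
    (continuous_snd (X := X) (Y := Y))).tendsto π).comp hπ
  constructor
  · have h : π.map (continuous_fst (X := X) (Y := Y)).measurable.aemeasurable = μ := by
      refine tendsto_nhds_unique h1 (tendsto_const_nhds.congr' ?_)
      filter_upwards [self_mem_nhdsWithin] with η hη
      exact Subtype.ext (hmem η hη).1.symm
    exact congrArg Subtype.val h
  · have h : π.map (continuous_snd (X := X) (Y := Y)).measurable.aemeasurable = ν := by
      refine tendsto_nhds_unique h2 (tendsto_const_nhds.congr' ?_)
      filter_upwards [self_mem_nhdsWithin] with η hη
      exact Subtype.ext (hmem η hη).2.symm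
    exact congrArg Subtype.val h

lemma le_liminf_measure_isOpen (hc : Continuous c)
    (hunif : TendstoUniformly cη c (𝓝[>] 0))
    (hform : ∀ᶠ η in 𝓝[>] 0, HasProductForm μ ν (cη η) η (πη η))
    (hmem : ∀ η > 0, πη η ∈ Couplings μ ν)
    (hπ : Tendsto πη (𝓝[>] 0) (𝓝 π))
    (huniq : UniqueKantorovichPotentials c (π : Measure (X × Y)).support)
    {U : Set (X × Y)} (hU : IsOpen U) :
    -(⨅ p ∈ U ∩ (Prod.fst '' (π : Measure (X × Y)).support) ×ˢ
        (Prod.snd '' (π : Measure (X × Y)).support),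
        cyclicalRate c (π : Measure (X × Y)).support p) ≤
      liminf (fun η : ℝ => (η : EReal) * ENNReal.log ((πη η : Measure (X × Y))
        (U ∩ (Prod.fst '' (π : Measure (X × Y)).support) ×ˢ
          (Prod.snd '' (π : Measure (X × Y)).support)))) (𝓝[>] 0) := by
  rw [EReal.neg_le]
  refine le_iInf₂ ?_
  rintro ⟨x, y⟩ ⟨hxy, ⟨⟨x, y'⟩, h, rfl⟩, ⟨⟨x', y⟩, h', rfl⟩⟩
  refine EReal.le_of_forall_lt_iff_le.1 fun r hr => ?_
  rw [EReal.neg_le]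
  refine le_liminf_of_le (by isBoundedDefault) ?_
  filter_upwards [eventually_le_measure_of_isOpen hc hunif hform hπ huniq hU hxy h h' hr,
    self_mem_nhdsWithin] with η hη hη0
  rw [measure_inter_prod_eq (couplings_of_tendsto hmem hπ) (hmem η hη0), ← EReal.coe_neg,
    ← coe_mul_log_exp_div hη0 (-r)]
  exact mul_le_mul_of_nonneg_left (ENNReal.log_le_log hη) (EReal.coe_nonneg.2 (le_of_lt hη0))

end LargeDeviations

end EOT

theorem theorem4p1 {X Y : Type*}
    [TopologicalSpace X] [PolishSpace X] [MeasurableSpace X] [BorelSpace X]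
    [TopologicalSpace Y] [PolishSpace Y] [MeasurableSpace Y] [BorelSpace Y]
    (μ : ProbabilityMeasure X) (ν : ProbabilityMeasure Y)
    (c : X × Y → ℝ) (hc : Continuous c)
    (hlow : ∃ (a : X → ℝ) (b : Y → ℝ), Integrable a (μ : Measure X) ∧
      Integrable b (ν : Measure Y) ∧ ∀ x y, a x + b y ≤ c (x, y))
    (cη : ℝ → X × Y → ℝ) (hcη : ∀ η > 0, Measurable (cη η))
    (hunif : TendstoUniformly cη c (𝓝[>] 0))
    (hfin : ∀ η > 0, ∃ π' ∈ EOT.Couplings μ ν, EOT.entropicCost μ ν (cη η) η π' < ⊤)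
    (πη : ℝ → ProbabilityMeasure (X × Y))
    (hmin : ∀ η > 0, EOT.IsEntropicMinimizer μ ν (cη η) η (πη η))
    (π : ProbabilityMeasure (X × Y)) (hπ : Tendsto πη (𝓝[>] 0) (𝓝 π))
    (Γ : Set (X × Y)) (hΓ : Γ = (π : Measure (X × Y)).support)
    (X₀ : Set X) (hX₀ : X₀ = Prod.fst '' Γ) (Y₀ : Set Y) (hY₀ : Y₀ = Prod.snd '' Γ)
    (huniq : EOT.UniqueKantorovichPotentials c Γ)
    (I : X × Y → EReal) (hI : I = EOT.cyclicalRate c Γ) :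
    (∀ p, 0 ≤ I p) ∧ LowerSemicontinuous I ∧
    (∀ G : Set (X × Y), (∃ U : Set (X × Y), IsOpen U ∧ G = U ∩ X₀ ×ˢ Y₀) →
      -(⨅ p ∈ G, I p) ≤
        liminf (fun η : ℝ => (η : EReal) * ENNReal.log ((πη η : Measure (X × Y)) G)) (𝓝[>] 0)) ∧
    (∀ K : Set (X × Y), IsCompact K →
      limsup (fun η : ℝ => (η : EReal) * ENNReal.log ((πη η : Measure (X × Y)) K)) (𝓝[>] 0) ≤
        -(⨅ p ∈ K, I p)) ∧
    (∀ ψ : X → EReal, EOT.IsKantorovichPotential c Γ ψ → ∀ x ∈ X₀, ∀ y ∈ Y₀,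
      I (x, y) = (c (x, y) : EReal) - (-ψ x + EOT.cTransform c ψ y)) := by
  subst hΓ hX₀ hY₀ hI
  have hform := EOT.eventually_hasProductForm hlow hcη hunif hfin hmin
  have hmem : ∀ η > 0, πη η ∈ EOT.Couplings μ ν := fun η hη => (hmin η hη).1
  have hcm : ∀ p ∈ (π : Measure (X × Y)).support,
      EOT.cyclicalRate c (π : Measure (X × Y)).support p ≤ 0 := fun p hp =>
    EOT.cyclicalRate_nonpos_of_mem_support hc hunif hform hπ hp
  refine ⟨EOT.cyclicalRate_nonneg (Measure.nonempty_support (IsProbabilityMeasure.ne_zero _)),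
    EOT.lowerSemicontinuous_cyclicalRate hc, ?_,
    fun K hK => EOT.limsup_measure_isCompact_le hc hunif hform hπ hK,
    fun ψ hψ x hx y hy => EOT.cyclicalRate_eq_of_isKantorovichPotential hcm huniq hψ hx hy⟩
  rintro G ⟨U, hU, rfl⟩
  exact EOT.le_liminf_measure_isOpen hc hunif hform hmem hπ huniq hU
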